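/- **Theorem 4.** For an undirected graph $G$ let $\mathrm{lp}(G)$ be the number of edges of a longest path in $G$; an algorithm solves Longest Path with approximation factor $\alpha$ and error probability $\varepsilon$ if on every input graph $G$ it outputs, with probability at least $1-\varepsilon$, a path $\mathcal Q$ of $G$ with $\mathrm{lp}(G)\le\alpha\cdot|\mathcal Q|$, where $|\mathcal Q|$ is the number of edges of $\mathcal Q$. Let $\gamma>0$ and $0<\varepsilon<1$. Then there are $c>0$ and $n_0$, depending only on $\gamma$ and $\varepsilon$, such that for all $n\ge n_0$: 1. every randomized one-way two-party communication protocol (with public and private randomness; the edges of the $n$-vertex undirected input graph are split between Alice and Bob, Alice sends a single message to Bob, and Bob outputs the path) that solves Longest Path on undirected $n$-vertex graphs with approximation factor $\frac{25}{24}-\gamma$ and error probability $\varepsilon$ has communication cost (maximum length of the message in bits) at least $n^{1+c/\log\log n}$; and 2. every randomized one-pass insertion-only streaming algorithm (the stream is an arbitrarily ordered sequence of the edges of the input graph) that solves Longest Path on undirected $n$-vertex graphs with approximation factor $\frac{25}{24}-\gamma$ and error probability $\varepsilon$ uses at least $n^{1+c/\log\log n}$ bits of space. That is, both require $n^{1+\Omega(1/\log\log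 n)}$ bits. -/

import Mathlib

/-! ### Longest paths in undirected graphs -/

/-- `lp(G)`: the length (number of edges) of a longest path in `G`. -/
noncomputable def longestPathLength {V : Type*} [Fintype V] (G : SimpleGraph V) : ℕ :=
  sSup {k : ℕ | ∃ (u v : V) (p : G.Walk u v), p.IsPath ∧ p.length = k}

/-- The vertex sequence `l` is the vertex sequence of a path `p` of `G` that is an
`α`-approximation to a longest path, i.e. `lp(G) ≤ α · |p|`. -/
def IsApproxLongestPath {V : Type*} [Fintype V] (α : ℝ) (G : SimpleGraph V) (l : List V) : Prop :=
  ∃ (u v : V) (p : G.Walk u v), p.IsPath ∧ p.support = l ∧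
    (longestPathLength G : ℝ) ≤ α * (p.length : ℝ)

/-! ### Randomness -/

/-- Infinite sequences of bits. -/
abbrev Coins : Type := ℕ → Bool

/-- The law of an infinite sequence of independent uniform random bits. -/
noncomputable def coinMeasure : MeasureTheory.Measure Coins :=
  MeasureTheory.Measure.infinitePi fun _ : ℕ => (PMF.uniformOfFintype Bool).toMeasure

/-! ### One-way two-party communication -/

/-- A randomized one-way two-party protocol with public and private randomness. Alice's message is
a bit string computed from her input, the public coins and her private coins; Bob's output is
computed from his input, the message, the public coins and his private coins. The last two fields
only say that the message and the output are random variables. -/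
structure OneWayProtocol (XA XB Out : Type) where
  /-- Alice's message: input, public coins, Alice's private coins. -/
  message : XA → Coins → Coins → List Bool
  /-- Bob's output: input, received message, public coins, Bob's private coins. -/
  output : XB → List Bool → Coins → Coins → Out
  measurable_message : ∀ (x : XA) (m : List Bool),
    MeasurableSet {ω : Coins × Coins | message x ω.1 ω.2 = m}
  measurable_output : ∀ (y : XB) (m : List Bool) (o : Out),
    MeasurableSet {ω : Coins × Coins | output y m ω.1 ω.2 = o}

/-- The output of the protocol on inputs `x`, `y`, public coins `R` and private coins `ra`, `rb`. -/
def OneWayProtocol.run {XA XB Out : Type} (P : OneWayProtocol XA XB Out) (x : XA) (y : XB)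
    (R ra rb : Coins) : Out :=
  P.output y (P.message x R ra) R rb

/-- The communication cost: the maximum length of the message in any execution
(`⊤` if the length is unbounded). -/
noncomputable def OneWayProtocol.cost {XA XB Out : Type} (P : OneWayProtocol XA XB Out) : ℕ∞ :=
  ⨆ (x : XA) (R : Coins) (ra : Coins), ((P.message x R ra).length : ℕ∞)

/-- `P` solves Longest Path on undirected graphs with `n` vertices with approximation factor `α`
and error probability at most `ε`: whenever the edges of the input graph are split between Alice
(`GA`) and Bob (`GB`), Bob outputs an `α`-approximate longest path of `GA ⊔ GB`, except with
probability at most `ε` over the three independent coin sequences. -/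
def OneWayProtocol.SolvesLongestPath {n : ℕ}
    (P : OneWayProtocol (SimpleGraph (Fin n)) (SimpleGraph (Fin n)) (List (Fin n)))
    (α ε : ℝ) : Prop :=
  ∀ GA GB : SimpleGraph (Fin n), Disjoint GA GB →
    (coinMeasure.prod (coinMeasure.prod coinMeasure)).real
      {ω : Coins × Coins × Coins |
        ¬ IsApproxLongestPath α (GA ⊔ GB) (P.run GA GB ω.1 ω.2.1 ω.2.2)} ≤ ε

/-! ### One-pass insertion-only streaming -/

/-- `l` is an insertion-only stream describing `G`: an arbitrarily ordered sequence of its edges. -/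
def IsInsertionStream {n : ℕ} (G : SimpleGraph (Fin n)) (l : List (Sym2 (Fin n))) : Prop :=
  l.Nodup ∧ ∀ e, e ∈ l ↔ e ∈ G.edgeSet

/-- A randomized one-pass streaming algorithm on graphs with vertex set `Fin n`, outputting a
sequence of vertices. Its memory is a bit string, updated at every arriving edge. Nothing but this
bit string is charged: the updates may be arbitrary functions, the coins may be reread at any time,
and the number of edges that arrived so far (the argument `ℕ` of `update`) is available for free.
The last three fields only say that the memory contents and the output are random variables. -/
structure StreamingAlgorithm (n : ℕ) where
  init : Coins → List Bool
  update : Coins → ℕ → List Bool → Sym2 (Fin n) → List Bool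
  output : Coins → List Bool → List (Fin n)
  measurable_init : ∀ σ : List Bool, MeasurableSet {ω : Coins | init ω = σ}
  measurable_update : ∀ (i : ℕ) (σ : List Bool) (e : Sym2 (Fin n)) (σ' : List Bool),
    MeasurableSet {ω : Coins | update ω i σ e = σ'}
  measurable_output : ∀ (σ : List Bool) (o : List (Fin n)),
    MeasurableSet {ω : Coins | output ω σ = o}

/-- The memory contents after processing the sequence of edges `l`. -/
def StreamingAlgorithm.memory {n : ℕ} (A : StreamingAlgorithm n) (ω : Coins)
    (l : List (Sym2 (Fin n))) : List Bool :=
  l.zipIdx.foldl (fun σ e => A.update ω e.2 σ e.1) (A.init ω)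

/-- The space: the maximum number of memory bits at any time during any execution on a stream
(`⊤` if unbounded). -/
noncomputable def StreamingAlgorithm.space {n : ℕ} (A : StreamingAlgorithm n) : ℕ∞ :=
  ⨆ (G : SimpleGraph (Fin n)) (l : List (Sym2 (Fin n))) (_ : IsInsertionStream G l)
    (i : ℕ) (ω : Coins), ((A.memory ω (l.take i)).length : ℕ∞)

/-- `A` solves Longest Path with approximation factor `α` and error probability at most `ε`
on every insertion-only stream describing an undirected graph with vertex set `Fin n`. -/
def StreamingAlgorithm.SolvesLongestPath {n : ℕ} (A : StreamingAlgorithm n) (α ε : ℝ) : Prop :=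
  ∀ (G : SimpleGraph (Fin n)) (l : List (Sym2 (Fin n))), IsInsertionStream G l →
    coinMeasure.real {ω : Coins | ¬ IsApproxLongestPath α G (A.output ω (A.memory ω l))} ≤ ε

/-!
The proof reduces a variant of the Index problem to approximating the longest path.

**Hard inputs.** A Ruzsa–Szemerédi graph is a bipartite graph whose edges split into many induced
matchings of linear size; here there are `n ^ Ω(1 / log log n)` of them, each covering a fifth of
the vertices (`exists_inducedMatchings`). The edges of each matching are grouped into `L` pairs,
called links, and the first player keeps one edge of each pair, according to a vector of
independent bits. The second player holds the index of a matching. He surrounds it by a gadget of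
`17 L + 1` long paths, the gaps, in which each of the `16 L` vertices outside the matching (a
hinge) and each link joins two gaps. If the kept edges are known, then there is a path that
traverses all gaps (`GadgetVertex.le_longestPathLength`).

**Approximate paths reveal bits.** Since the matching is induced, every edge of the first player
that is not a candidate edge of the matching has an endpoint in a hinge. Counting the path edges
at the hinges, of which there are at most two each, a path that uses few candidate edges crosses
little more than `16 L` gaps (`GadgetVertex.card_isCrossed_le`). As `17 / 16 > 25 / 24`, a `25 /
24`-approximate longest path contains at least `L / 10` candidate edges of the matching, all of
which the first player must have kept (`GadgetVertex.candidate_edges_of_approx`,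
`nonempty_hardInputs`).

**Counting.** Fix the random bits so that a constant fraction of all pairs of inputs is answered
correctly (`exists_outcome_few_failures`). For a fixed message, each correct answer to an index
prescribes `L / 10` bits of the corresponding matching, so that only a tiny fraction of the
vectors admits a constant fraction of correct answers. Hence there must be `2 ^ Ω(L t)` messages,
where `t` is the number of matchings (`message_length_bound`). This works for every error
probability below `1` because a wrong guess of an edge makes the output invalid.

A streaming algorithm yields a protocol whose message is the memory contents. The number of edges
of the first player does not depend on her bits, so the second player knows it.
-/

/-! ### Counting bit vectors consistent with a short message -/

/-- Prescribing the bits on a set `P` of coordinates leaves a `2 ^ (-#P)` fraction of all bit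
vectors. -/
lemma card_filter_prescribed_mul {κ : Type*} [Fintype κ] [DecidableEq κ] (P : Finset κ)
    (g : κ → Bool) :
    (Finset.univ.filter fun f : κ → Bool => ∀ x ∈ P, f x = g x).card * 2 ^ P.card =
      2 ^ Fintype.card κ := by
  have h1 : (Finset.univ.filter fun f : κ → Bool => ∀ x ∈ P, f x = g x) =
      Fintype.piFinset (fun x => if x ∈ P then {g x} else Finset.univ) := by
    ext f
    simp only [Finset.mem_filter, Finset.mem_univ, true_and, Fintype.mem_piFinset]
    refine forall_congr' fun x => ?_
    split_ifs with h <;> simp [h]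
  have h2 : ∀ x, (if x ∈ P then ({g x} : Finset Bool) else Finset.univ).card =
      if x ∈ P then 1 else 2 := by
    intro x; split_ifs <;> simp
  rw [h1, Fintype.card_piFinset]
  simp only [h2]
  rw [Finset.prod_ite]
  simp only [Finset.prod_const_one, Finset.prod_const, one_mul]
  rw [← pow_add]
  congr 1
  have := Finset.card_filter_add_card_filter_not (s := (Finset.univ : Finset κ)) (· ∈ P)
  rw [Finset.filter_mem_eq_inter, Finset.univ_inter] at this
  simp only [Finset.card_univ] at this
  omega

/-- If every message `m` together with an index `i` pins down at least `K` bits of block `i` of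
each vector `f` that is sent as `m` and for which `i` is answered correctly, then few vectors have
`h` correctly answered indices. -/
lemma card_many_correct_mul_le {I κ M : Type*} [Fintype I] [DecidableEq I] [Fintype κ]
    [DecidableEq κ] (msg : (I × κ → Bool) → M) (𝓜 : Finset M) (hmsg : ∀ f, msg f ∈ 𝓜)
    (correct : (I × κ → Bool) → I → Prop) [∀ f i, Decidable (correct f i)] (K h : ℕ)
    (hK : ∀ m i, ∃ (P : Finset κ) (g : κ → Bool), K ≤ P.card ∧
      ∀ f, msg f = m → correct f i → ∀ x ∈ P, f (i, x) = g x) :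
    (Finset.univ.filter fun f => h ≤ (Finset.univ.filter (correct f)).card).card * 2 ^ (K * h) ≤
      𝓜.card * 2 ^ Fintype.card I * 2 ^ Fintype.card (I × κ) := by
  classical
  choose P g hP hg using hK
  let Q : M → Finset I → Finset (I × κ) := fun m J =>
    Finset.univ.filter fun x => x.1 ∈ J ∧ x.2 ∈ P m x.1
  let E : M → Finset I → Finset (I × κ → Bool) := fun m J =>
    Finset.univ.filter fun f => ∀ x ∈ Q m J, f x = g m x.1 x.2
  have hQ : ∀ m J, K * J.card ≤ (Q m J).card := by
    intro m J
    have : Q m J = J.biUnion fun i => (P m i).image (Prod.mk i) := by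
      ext ⟨i, x⟩
      simp [Q]
    rw [this, Finset.card_biUnion]
    · rw [mul_comm, ← smul_eq_mul]
      refine Finset.card_nsmul_le_sum _ _ _ fun i _ => ?_
      rw [Finset.card_image_of_injective _ (Prod.mk_right_injective i)]
      exact hP m i
    · intro i _ j _ hij
      rw [Function.onFun, Finset.disjoint_left]
      rintro ⟨a, b⟩ h1 h2
      simp only [Finset.mem_image, Prod.mk.injEq, exists_eq_right_right] at h1 h2
      exact hij (h1.2.trans h2.2.symm)
  have hE : ∀ m J, h ≤ J.card → (E m J).card * 2 ^ (K * h) ≤ 2 ^ Fintype.card (I × κ) := by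
    intro m J hJ
    rw [← card_filter_prescribed_mul (Q m J) (fun x => g m x.1 x.2)]
    refine Nat.mul_le_mul_left _ (Nat.pow_le_pow_right (by norm_num) ?_)
    exact (Nat.mul_le_mul_left K hJ).trans (hQ m J)
  have hsub : (Finset.univ.filter fun f => h ≤ (Finset.univ.filter (correct f)).card) ⊆
      (𝓜 ×ˢ (Finset.univ.filter fun J : Finset I => h ≤ J.card)).biUnion
        fun y => E y.1 y.2 := by
    intro f hf
    rw [Finset.mem_biUnion]
    refine ⟨(msg f, Finset.univ.filter (correct f)), ?_, ?_⟩
    · simpa [hmsg] using hf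
    · simp only [E, Q, Finset.mem_filter, Finset.mem_univ, true_and]
      rintro ⟨i, x⟩ ⟨hi, hx⟩
      exact hg _ i f rfl hi x hx
  calc _ ≤ (∑ y ∈ 𝓜 ×ˢ (Finset.univ.filter fun J : Finset I => h ≤ J.card),
          (E y.1 y.2).card) * 2 ^ (K * h) :=
        Nat.mul_le_mul_right _ ((Finset.card_le_card hsub).trans Finset.card_biUnion_le)
    _ = ∑ y ∈ 𝓜 ×ˢ (Finset.univ.filter fun J : Finset I => h ≤ J.card),
          (E y.1 y.2).card * 2 ^ (K * h) := Finset.sum_mul _ _ _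
    _ ≤ ∑ y ∈ 𝓜 ×ˢ (Finset.univ.filter fun J : Finset I => h ≤ J.card),
          2 ^ Fintype.card (I × κ) := by
        refine Finset.sum_le_sum fun y hy => hE _ _ ?_
        simpa using (Finset.mem_product.1 hy).2
    _ = 𝓜.card * (Finset.univ.filter fun J : Finset I => h ≤ J.card).card *
          2 ^ Fintype.card (I × κ) := by
        rw [Finset.sum_const, smul_eq_mul, Finset.card_product]
    _ ≤ _ := by
        gcongr
        rw [← Fintype.card_finset]
        exact Finset.card_le_univ _

/-- Fewer than `2 ^ (s + 1)` bit strings have length at most `s`. -/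
lemma exists_finset_bitstrings (s : ℕ) :
    ∃ 𝓜 : Finset (List Bool), (∀ l : List Bool, l.length ≤ s → l ∈ 𝓜) ∧ 𝓜.card ≤ 2 ^ (s + 1) := by
  classical
  refine ⟨(Finset.range (s + 1)).biUnion fun k =>
    (Finset.univ : Finset (Fin k → Bool)).image List.ofFn, ?_, ?_⟩
  · intro l hl
    simp only [Finset.mem_biUnion, Finset.mem_range, Finset.mem_image, Finset.mem_univ, true_and]
    exact ⟨l.length, by omega, l.get, List.ofFn_get l⟩
  · refine Finset.card_biUnion_le.trans ?_
    calc _ ≤ ∑ k ∈ Finset.range (s + 1), 2 ^ k :=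
          Finset.sum_le_sum fun k _ => Finset.card_image_le.trans (by simp)
      _ ≤ 2 ^ (s + 1) := by
          have := Nat.geomSum_eq (le_refl 2) (s + 1)
          rw [this]
          simp

/-- A finite family of events of probability at most `ε` admits an outcome lying in at most an `ε`
fraction of them. The events need not be measurable. -/
lemma exists_outcome_few_failures {Ω J : Type*} [MeasurableSpace Ω] [Fintype J]
    (μ : MeasureTheory.Measure Ω) [MeasureTheory.IsProbabilityMeasure μ] (F : J → Set Ω)
    [∀ ω j, Decidable (ω ∈ F j)] (ε : ℝ) (hF : ∀ j, μ.real (F j) ≤ ε) :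
    ∃ ω, ((Finset.univ.filter fun j => ω ∈ F j).card : ℝ) ≤ ε * Fintype.card J := by
  classical
  let φ : Ω → ℝ := fun ω => ∑ j, (MeasureTheory.toMeasurable μ (F j)).indicator 1 ω
  have hmeas : ∀ j, MeasurableSet (MeasureTheory.toMeasurable μ (F j)) := fun j =>
    MeasureTheory.measurableSet_toMeasurable _ _
  have hint : ∀ j, MeasureTheory.Integrable
      ((MeasureTheory.toMeasurable μ (F j)).indicator (1 : Ω → ℝ)) μ := fun j =>
    (MeasureTheory.integrable_const (1 : ℝ)).indicator (hmeas j)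
  have hφ : MeasureTheory.Integrable φ μ := MeasureTheory.integrable_finsetSum _ fun j _ => hint j
  obtain ⟨ω, hω⟩ := MeasureTheory.exists_le_integral hφ
  refine ⟨ω, ?_⟩
  have h1 : ((Finset.univ.filter fun j => ω ∈ F j).card : ℝ) ≤ φ ω := by
    rw [Finset.card_filter]
    push_cast
    refine Finset.sum_le_sum fun j _ => ?_
    by_cases hj : ω ∈ F j
    · simp [hj, MeasureTheory.subset_toMeasurable μ (F j) hj]
    · simp only [hj, if_false]
      exact Set.indicator_nonneg (fun _ _ => zero_le_one) _
  refine h1.trans (hω.trans ?_)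
  rw [MeasureTheory.integral_finsetSum _ fun j _ => hint j]
  calc _ ≤ ∑ _j : J, ε := by
        refine Finset.sum_le_sum fun j _ => ?_
        rw [MeasureTheory.integral_indicator_one (hmeas j), MeasureTheory.Measure.real,
          MeasureTheory.measure_toMeasurable]
        exact hF j
    _ = _ := by simp [mul_comm]

/-- The information bottleneck: a randomized protocol with `s`-bit messages under which a correct
answer to an index always reveals `K` bits of the corresponding block, and which is correct with
probability at least `1 - ε` for each input, satisfies `(1 - ε) / 2 · 2 ^ (K h) ≤ 2 ^ (s + 1 + |I|)`
for every `h ≤ (1 - ε) |I| / 2`. -/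
theorem message_length_bound {Ω I κ : Type*} [MeasurableSpace Ω] [Fintype I] [Nonempty I]
    [DecidableEq I] [Fintype κ] [DecidableEq κ] (μ : MeasureTheory.Measure Ω)
    [MeasureTheory.IsProbabilityMeasure μ] (msg : Ω → (I × κ → Bool) → List Bool) (s : ℕ)
    (hs : ∀ ω f, (msg ω f).length ≤ s) (correct : Ω → (I × κ → Bool) → I → Prop) (K h : ℕ)
    (hK : ∀ ω m i, ∃ (P : Finset κ) (g : κ → Bool), K ≤ P.card ∧
      ∀ f, msg ω f = m → correct ω f i → ∀ x ∈ P, f (i, x) = g x)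
    (ε : ℝ) (hcorrect : ∀ f i, μ.real {ω | ¬ correct ω f i} ≤ ε)
    (hh : (h : ℝ) ≤ (1 - ε) / 2 * Fintype.card I) :
    (1 - ε) / 2 * 2 ^ (K * h) ≤ (2 : ℝ) ^ (s + 1 + Fintype.card I) := by
  classical
  obtain ⟨ω, hω⟩ := exists_outcome_few_failures μ
    (fun y : (I × κ → Bool) × I => {ω | ¬ correct ω y.1 y.2}) ε fun y => hcorrect y.1 y.2
  obtain ⟨𝓜, h𝓜, h𝓜c⟩ := exists_finset_bitstrings s
  have hmain := card_many_correct_mul_le (msg ω) 𝓜 (fun f => h𝓜 _ (hs ω f)) (correct ω) K h (hK ω)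
  set good := Finset.univ.filter fun f => h ≤ (Finset.univ.filter (correct ω f)).card with hgood
  have hFcard : Fintype.card (I × κ → Bool) = 2 ^ Fintype.card (I × κ) := by simp
  set N := Fintype.card (I × κ → Bool) with hN
  have hNpos : 0 < N := Fintype.card_pos
  have hIpos : 0 < Fintype.card I := Fintype.card_pos
  have hsum : (∑ f : I × κ → Bool, ((Finset.univ.filter (correct ω f)).card : ℝ)) +
      (Finset.univ.filter fun y : (I × κ → Bool) × I => ¬ correct ω y.1 y.2).card =
      N * Fintype.card I := by
    have e1 : (∑ f : I × κ → Bool, (Finset.univ.filter (correct ω f)).card) =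
        (Finset.univ.filter fun y : (I × κ → Bool) × I => correct ω y.1 y.2).card := by
      simp only [Finset.card_filter]
      rw [Fintype.sum_prod_type]
    have e2 := Finset.card_filter_add_card_filter_not
      (s := (Finset.univ : Finset ((I × κ → Bool) × I))) (fun y => correct ω y.1 y.2)
    rw [← e1, Finset.card_univ, Fintype.card_prod] at e2
    exact_mod_cast e2
  have hupper : (∑ f : I × κ → Bool, ((Finset.univ.filter (correct ω f)).card : ℝ)) ≤
      good.card * Fintype.card I + N * h := by
    calc _ ≤ ∑ f : I × κ → Bool, ((if f ∈ good then (Fintype.card I : ℝ) else 0) + h) := by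
          refine Finset.sum_le_sum fun f _ => ?_
          split_ifs with hf
          · have : (Finset.univ.filter (correct ω f)).card ≤ Fintype.card I :=
              Finset.card_le_univ _
            have : ((Finset.univ.filter (correct ω f)).card : ℝ) ≤ Fintype.card I := by
              exact_mod_cast this
            linarith [Nat.cast_nonneg (α := ℝ) h]
          · have : (Finset.univ.filter (correct ω f)).card ≤ h := by
              simp only [hgood, Finset.mem_filter, Finset.mem_univ, true_and, not_le] at hf
              exact hf.le
            rw [zero_add]
            exact_mod_cast this
      _ = _ := by
          rw [Finset.sum_add_distrib, Finset.sum_const, Finset.sum_ite_mem, Finset.univ_inter,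
            Finset.sum_const]
          simp [hN]
  have hfail : ((Finset.univ.filter
      fun y : (I × κ → Bool) × I => ¬ correct ω y.1 y.2).card : ℝ) ≤
      ε * (N * Fintype.card I) := by
    simpa [Fintype.card_prod, hN] using hω
  have hgoodR : (1 - ε) / 2 * N ≤ good.card := by
    have hI : (0 : ℝ) < Fintype.card I := by exact_mod_cast hIpos
    have hNR : (0 : ℝ) ≤ N := Nat.cast_nonneg _
    have h3 : (N : ℝ) * h ≤ N * ((1 - ε) / 2 * Fintype.card I) :=
      mul_le_mul_of_nonneg_left hh hNR
    have : (1 - ε) / 2 * N * Fintype.card I ≤ good.card * Fintype.card I := by nlinarith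
    exact le_of_mul_le_mul_right this hI
  have hmainR : (good.card : ℝ) * 2 ^ (K * h) ≤
      2 ^ (s + 1) * 2 ^ Fintype.card I * N := by
    have : good.card * 2 ^ (K * h) ≤ 2 ^ (s + 1) * 2 ^ Fintype.card I * N := by
      rw [hFcard]
      exact hmain.trans (by gcongr)
    exact_mod_cast this
  have hNR : (0 : ℝ) < N := by exact_mod_cast hNpos
  have : (1 - ε) / 2 * 2 ^ (K * h) * N ≤ (2 : ℝ) ^ (s + 1 + Fintype.card I) * N := by
    rw [pow_add]
    calc _ = (1 - ε) / 2 * N * 2 ^ (K * h) := by ring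
      _ ≤ good.card * 2 ^ (K * h) := by gcongr
      _ ≤ _ := hmainR
  exact le_of_mul_le_mul_right this hNR

/-! ### Binary codes of linear rate and distance -/

/-- The weight enumerator of the Hamming cube around any point. -/
lemma sum_pow_hammingDist {k : ℕ} (x : Fin k → Bool) (z : ℝ) :
    ∑ y : Fin k → Bool, z ^ hammingDist x y = (1 + z) ^ k := by
  have h1 : ∀ y : Fin k → Bool, z ^ hammingDist x y = ∏ i, if x i ≠ y i then z else 1 := by
    intro y
    rw [Finset.prod_ite, Finset.prod_const_one, mul_one, Finset.prod_const, hammingDist]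
  simp only [h1]
  have h2 := Finset.prod_univ_sum (fun _ : Fin k => (Finset.univ : Finset Bool))
    (fun i b => if x i ≠ b then z else 1)
  rw [Fintype.piFinset_univ] at h2
  rw [← h2]
  have h3 : ∀ i, (∑ b : Bool, if x i ≠ b then z else 1) = 1 + z := by
    intro i
    cases x i <;> simp [add_comm]
  rw [Finset.prod_congr rfl fun i _ => h3 i, Finset.prod_const, Finset.card_univ, Fintype.card_fin]

/-- Gilbert–Varshamov: a maximal code of length `4r` and minimum distance `r` has at least
`(27/16)^r` words, as balls of radius `r` around its words cover the cube. The volume of a ball is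
bounded by the weight enumerator at `1/3`. -/
lemma exists_binary_code (r : ℕ) (hr : 0 < r) :
    ∃ C : Finset (Fin (4 * r) → Bool), (∀ x ∈ C, ∀ y ∈ C, x ≠ y → r ≤ hammingDist x y) ∧
      ((27 : ℝ) / 16) ^ r ≤ C.card := by
  classical
  obtain ⟨C, hC, hmax⟩ := Finset.exists_max_image
    (Finset.univ.filter fun C : Finset (Fin (4 * r) → Bool) =>
      ∀ x ∈ C, ∀ y ∈ C, x ≠ y → r ≤ hammingDist x y) Finset.card ⟨∅, by simp⟩
  simp only [Finset.mem_filter, Finset.mem_univ, true_and] at hC hmax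
  refine ⟨C, hC, ?_⟩
  have hcover : ∀ y, ∃ c ∈ C, hammingDist c y < r := by
    intro y
    by_contra! hfar
    have hy : y ∉ C := fun hy => by
      have := hfar y hy
      rw [hammingDist_self] at this
      omega
    have := hmax (insert y C) (by
      intro a ha b hb hab
      rcases Finset.mem_insert.1 ha with ha' | ha' <;>
        rcases Finset.mem_insert.1 hb with hb' | hb'
      · exact absurd (ha'.trans hb'.symm) hab
      · rw [hammingDist_comm, ha']; exact hfar b hb'
      · rw [hb']; exact hfar a ha'
      · exact hC a ha' b hb' hab)
    rw [Finset.card_insert_of_notMem hy] at this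
    omega
  have hball : ∀ c : Fin (4 * r) → Bool,
      ((Finset.univ.filter fun y => hammingDist c y < r).card : ℝ) ≤ (256 / 27) ^ r := by
    intro c
    have h1 : ((Finset.univ.filter fun y => hammingDist c y < r).card : ℝ) * (1 / 3) ^ r ≤
        (1 + 1 / 3) ^ (4 * r) := by
      rw [← sum_pow_hammingDist c, ← nsmul_eq_mul]
      calc _ ≤ ∑ y ∈ Finset.univ.filter (fun y => hammingDist c y < r),
            ((1 : ℝ) / 3) ^ hammingDist c y := by
            refine Finset.card_nsmul_le_sum _ _ _ fun y hy => ?_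
            exact pow_le_pow_of_le_one (by norm_num) (by norm_num) (Finset.mem_filter.1 hy).2.le
        _ ≤ _ := Finset.sum_le_sum_of_subset_of_nonneg (Finset.subset_univ _)
            fun _ _ _ => by positivity
    have h2 : ((1 : ℝ) + 1 / 3) ^ (4 * r) = (256 / 27) ^ r * (1 / 3) ^ r := by
      rw [pow_mul, ← mul_pow]; norm_num
    rw [h2] at h1
    exact le_of_mul_le_mul_right h1 (by positivity)
  have htotal : ((2 : ℝ) ^ (4 * r)) ≤ C.card * (256 / 27) ^ r := by
    have hsub : (Finset.univ : Finset (Fin (4 * r) → Bool)) ⊆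
        C.biUnion fun c => Finset.univ.filter fun y => hammingDist c y < r := by
      intro y _
      obtain ⟨c, hc, hcy⟩ := hcover y
      simp only [Finset.mem_biUnion, Finset.mem_filter, Finset.mem_univ, true_and]
      exact ⟨c, hc, hcy⟩
    have h1 := (Finset.card_le_card hsub).trans Finset.card_biUnion_le
    rw [Finset.card_univ, Fintype.card_fun, Fintype.card_fin, Fintype.card_bool] at h1
    calc ((2 : ℝ) ^ (4 * r)) ≤
          ∑ c ∈ C, ((Finset.univ.filter fun y => hammingDist c y < r).card : ℝ) := by
          exact_mod_cast h1
      _ ≤ ∑ _c ∈ C, ((256 : ℝ) / 27) ^ r := Finset.sum_le_sum fun c _ => hball c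
      _ = _ := by rw [Finset.sum_const, nsmul_eq_mul]
  have h3 : ((2 : ℝ) ^ (4 * r)) = (27 / 16) ^ r * (256 / 27) ^ r := by
    rw [pow_mul, ← mul_pow]; norm_num
  rw [h3] at htotal
  exact le_of_mul_le_mul_right htotal (by positivity)

/-! ### Ruzsa–Szemerédi graphs: many large edge-disjoint induced matchings -/

/-- A family, indexed by `I`, of matchings between two copies of `X`, each with its edges labelled
by `E`, such that every matching is induced in the union of all of them: an edge of the union that
joins endpoints of the `i`-th matching belongs to the `i`-th matching. -/
structure InducedMatchings (I E X : Type) where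
  /-- The endpoint of an edge in the left copy of `X`. -/
  left : I → E → X
  /-- The endpoint of an edge in the right copy of `X`. -/
  right : I → E → X
  left_injective : ∀ i, Function.Injective (left i)
  right_injective : ∀ i, Function.Injective (right i)
  induced : ∀ i j e e₁ e₂, left j e = left i e₁ → right j e = right i e₂ → j = i

/-- Disjoint copies, indexed by `T`, of a family of induced matchings, with the edges relabelled
along an equivalence. -/
def InducedMatchings.copies {I E X E' : Type} (R : InducedMatchings I E X) (T : Type)
    (φ : E' ≃ E × T) : InducedMatchings I E' (X × T) where
  left i e := (R.left i (φ e).1, (φ e).2)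
  right i e := (R.right i (φ e).1, (φ e).2)
  left_injective i e e' h := by
    rw [Prod.mk.injEq] at h
    exact φ.injective (Prod.ext (R.left_injective i h.1) h.2)
  right_injective i e e' h := by
    rw [Prod.mk.injEq] at h
    exact φ.injective (Prod.ext (R.right_injective i h.1) h.2)
  induced i j e e₁ e₂ h₁ h₂ := by
    rw [Prod.mk.injEq] at h₁ h₂
    exact R.induced i j _ _ _ h₁.1 h₂.1

/-- The sum of the coordinates of `x` selected by the word `c`. -/
def codeSum {k p : ℕ} (c : Fin k → Bool) : (Fin k → Bool → ZMod p) →+ ZMod p where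
  toFun x := ∑ i, x i (c i)
  map_zero' := by simp
  map_add' x y := by simp [Finset.sum_add_distrib]

/-- The indicator vector of the coordinates selected by the word `c`. -/
def codeShift {k p : ℕ} (c : Fin k → Bool) : Fin k → Bool → ZMod p :=
  fun i b => if b = c i then 1 else 0

lemma codeSum_codeShift {k p : ℕ} (c c' : Fin k → Bool) :
    codeSum c (codeShift c' : Fin k → Bool → ZMod p) = ((k - hammingDist c c' : ℕ) : ZMod p) := by
  have h : (Finset.univ.filter fun i => c i = c' i).card = k - hammingDist c c' := by
    have := Finset.card_filter_add_card_filter_not (s := (Finset.univ : Finset (Fin k)))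
      (fun i => c i = c' i)
    rw [Finset.card_univ, Fintype.card_fin] at this
    simp only [hammingDist, ne_eq]
    omega
  rw [← h]
  simp [codeSum, codeShift]

lemma codeSum_surjective {k p : ℕ} (hk : 0 < k) (c : Fin k → Bool) :
    Function.Surjective (codeSum (p := p) c) := by
  intro v
  refine ⟨fun i _ => if i = ⟨0, hk⟩ then v else 0, ?_⟩
  simp [codeSum]

/-- The sum selected by `c` lies in `[0, r)` modulo `5r` for exactly a fifth of all vectors. -/
lemma card_codeSum_val_lt {k r : ℕ} [NeZero (5 * r)] (hk : 0 < k) (c : Fin k → Bool) :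
    5 * Fintype.card {x : Fin k → Bool → ZMod (5 * r) // (codeSum c x).val < r} =
      Fintype.card (Fin k → Bool → ZMod (5 * r)) := by
  classical
  set q := (Finset.univ.filter fun x : Fin k → Bool → ZMod (5 * r) => codeSum c x = 0).card
  have hfib : ∀ v : ZMod (5 * r),
      (Finset.univ.filter fun x : Fin k → Bool → ZMod (5 * r) => codeSum c x = v).card = q :=
    fun v => AddMonoidHom.card_fiber_eq_of_mem_range (codeSum c)
      (codeSum_surjective hk c v) (codeSum_surjective hk c 0)
  have hcount : ∀ A : Finset (ZMod (5 * r)),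
      (Finset.univ.filter fun x : Fin k → Bool → ZMod (5 * r) => codeSum c x ∈ A).card =
        A.card * q := by
    intro A
    rw [Finset.card_eq_sum_card_fiberwise (f := codeSum c) (t := A)
      (fun x hx => by simpa using hx)]
    refine Finset.sum_const_nat fun v hv => ?_
    rw [← hfib v, Finset.filter_filter]
    congr 1
    ext x
    simp only [Finset.mem_filter, Finset.mem_univ, true_and]
    exact ⟨fun h => h.2, fun h => ⟨h ▸ hv, h⟩⟩
  have h1 := hcount Finset.univ
  simp only [Finset.mem_univ, Finset.filter_true, Finset.card_univ, ZMod.card] at h1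
  have h2 := hcount (Finset.univ.filter fun v => v.val < r)
  have h3 : (Finset.univ.filter fun v : ZMod (5 * r) => v.val < r).card = r := by
    have hr : r ≤ 5 * r := by omega
    have : (Finset.univ.filter fun v : ZMod (5 * r) => v.val < r) =
        (Finset.range r).image (fun j : ℕ => (j : ZMod (5 * r))) := by
      ext v
      simp only [Finset.mem_filter, Finset.mem_univ, true_and, Finset.mem_image, Finset.mem_range]
      constructor
      · intro h; exact ⟨v.val, h, ZMod.natCast_zmod_val v⟩
      · rintro ⟨j, hj, rfl⟩
        rw [ZMod.val_natCast_of_lt (by omega)]; exact hj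
    rw [this, Finset.card_image_of_injOn, Finset.card_range]
    intro a ha b hb hab
    have ha' : a < r := Finset.mem_range.1 (Finset.mem_coe.1 ha)
    have hb' : b < r := Finset.mem_range.1 (Finset.mem_coe.1 hb)
    have := congrArg ZMod.val hab
    simp only at this
    rwa [ZMod.val_natCast_of_lt (by omega), ZMod.val_natCast_of_lt (by omega)] at this
  simp only [Finset.mem_filter, Finset.mem_univ, true_and] at h2
  rw [h3] at h2
  rw [Fintype.card_subtype, h1, h2]
  ring

/-- The Ruzsa–Szemerédi graphs of the lower bound. The matchings are indexed by the words `c` of a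
binary code of length `4r` and minimum distance `r`; the `c`-th one consists of the edges from `x`
to `x + codeShift c` with `codeSum c x ∈ [0, r)` modulo `5r`. It is induced: the right
endpoints have `codeSum c` in `[4r, 5r)`, and moving along an edge of another matching, the sum of
a left endpoint grows by at most `3r`, which leads to `[0, 4r)`. -/
theorem exists_inducedMatchings (r : ℕ) (hr : 0 < r) :
    ∃ (I : Type) (_ : Fintype I) (_ : DecidableEq I) (X : Type) (_ : Fintype X) (q : ℕ)
      (_ : InducedMatchings I (Fin q) X),
      ((27 : ℝ) / 16) ^ r ≤ Fintype.card I ∧ Fintype.card X = 5 * q ∧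
      Fintype.card X = (5 * r) ^ (8 * r) := by
  classical
  obtain ⟨C, hdist, hcard⟩ := exists_binary_code r hr
  have : NeZero (5 * r) := ⟨by omega⟩
  have hX : Fintype.card (Fin (4 * r) → Bool → ZMod (5 * r)) = (5 * r) ^ (8 * r) := by
    simp only [Fintype.card_fun, ZMod.card, Fintype.card_bool, Fintype.card_fin]
    rw [← pow_mul]
    congr 1
    ring
  have hS : ∀ c : Fin (4 * r) → Bool,
      5 * Fintype.card {x : Fin (4 * r) → Bool → ZMod (5 * r) // (codeSum c x).val < r} =
        (5 * r) ^ (8 * r) := fun c => by rw [card_codeSum_val_lt (by omega), hX]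
  obtain ⟨q, hq⟩ : ∃ q, 5 * q = (5 * r) ^ (8 * r) := ⟨_, hS fun _ => true⟩
  have hSq : ∀ c : Fin (4 * r) → Bool,
      Fintype.card (Fin q) =
      Fintype.card {x : Fin (4 * r) → Bool → ZMod (5 * r) // (codeSum c x).val < r} := by
    intro c
    have := hS c
    rw [Fintype.card_fin]
    omega
  let φ := fun c => Fintype.equivOfCardEq (hSq c)
  refine ⟨C, inferInstance, inferInstance, Fin (4 * r) → Bool → ZMod (5 * r), inferInstance, q,
    { left := fun c e => (φ c e).1
      right := fun c e => (φ c e).1 + codeShift c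
      left_injective := fun c e e' h => (φ c).injective (Subtype.ext h)
      right_injective := fun c e e' h => (φ c).injective (Subtype.ext (add_right_cancel h))
      induced := ?_ }, by simpa using hcard, by rw [hX, hq], hX⟩
  rintro ⟨i, hi⟩ ⟨j, hj⟩ e e₁ e₂ h₁ h₂
  by_contra hne
  rw [Subtype.mk.injEq] at hne
  have hd := hdist i hi j hj (Ne.symm hne)
  simp only at h₁ h₂
  rw [h₁] at h₂
  have h₃ := congrArg (codeSum i) h₂
  rw [map_add, map_add, codeSum_codeShift, codeSum_codeShift, hammingDist_self] at h₃
  have hx := (φ i e₁).2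
  have hy := (φ i e₂).2
  rw [← ZMod.natCast_zmod_val (codeSum i (φ i e₁).1),
    ← ZMod.natCast_zmod_val (codeSum i (φ i e₂).1), ← Nat.cast_add, ← Nat.cast_add] at h₃
  have h₄ := congrArg ZMod.val h₃
  rw [ZMod.val_natCast_of_lt (by omega), ZMod.val_natCast_of_lt (by omega)] at h₄
  omega

/-! ### Paths and their neighbours -/

section PathNeighbours

variable {V : Type*} {G : SimpleGraph V}

/-- A vertex has at most two neighbours on a path. -/
lemma card_pathNeighbours_le_two [Fintype V] {u v : V} {p : G.Walk u v}
    (hp : p.IsPath) (x : V) [DecidablePred fun y => s(x, y) ∈ p.edges] :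
    (Finset.univ.filter fun y => s(x, y) ∈ p.edges).card ≤ 2 := by
  by_cases hx : x ∈ p.support
  swap
  · have : (Finset.univ.filter fun y => s(x, y) ∈ p.edges) = ∅ := by
      ext y
      simp only [Finset.mem_filter, Finset.mem_univ, true_and, Finset.notMem_empty, iff_false]
      exact fun h => hx (p.fst_mem_support_of_mem_edges h)
    simp [this]
  have hset : (p.toSubgraph.neighborSet x).ncard =
      (Finset.univ.filter fun y => s(x, y) ∈ p.edges).card := by
    rw [← Set.ncard_coe_finset]
    congr 1
    ext y
    simp [← SimpleGraph.Walk.adj_toSubgraph_iff_mem_edges]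
  rw [← hset]
  obtain ⟨i, rfl, hi⟩ := p.mem_support_iff_exists_getVert.1 hx
  by_cases hnil : p.Nil
  · have : (p.toSubgraph.neighborSet (p.getVert i)) = ∅ := by
      ext y
      simp [SimpleGraph.Walk.adj_toSubgraph_iff_mem_edges,
        SimpleGraph.Walk.edges_eq_nil.2 hnil]
    simp [this]
  rcases Nat.eq_zero_or_pos i with rfl | h0
  · rw [SimpleGraph.Walk.getVert_zero, hp.neighborSet_toSubgraph_startpoint hnil]
    simp
  rcases hi.eq_or_lt with rfl | hlt
  · rw [SimpleGraph.Walk.getVert_length, hp.neighborSet_toSubgraph_endpoint hnil]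
    simp
  · rw [hp.ncard_neighborSet_toSubgraph_internal_eq_two h0.ne' hlt]

/-- An inner vertex of a path has exactly two neighbours on it. -/
lemma card_pathNeighbours_eq_two [Fintype V] {u v : V} {p : G.Walk u v}
    (hp : p.IsPath) {x : V} [DecidablePred fun y => s(x, y) ∈ p.edges]
    (hx : x ∈ p.support) (hu : x ≠ u) (hv : x ≠ v) :
    (Finset.univ.filter fun y => s(x, y) ∈ p.edges).card = 2 := by
  have hset : (p.toSubgraph.neighborSet x).ncard =
      (Finset.univ.filter fun y => s(x, y) ∈ p.edges).card := by
    rw [← Set.ncard_coe_finset]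
    congr 1
    ext y
    simp [← SimpleGraph.Walk.adj_toSubgraph_iff_mem_edges]
  rw [← hset]
  obtain ⟨i, rfl, hi⟩ := p.mem_support_iff_exists_getVert.1 hx
  refine hp.ncard_neighborSet_toSubgraph_internal_eq_two ?_ (hi.lt_of_ne ?_)
  · rintro rfl; exact hu p.getVert_zero
  · rintro rfl; exact hv p.getVert_length

/-- `IsClimb G ρ a v k`: some path of length at least `k` leads from `a` to `v` through vertices of
rank at most that of `v`. -/
def IsClimb (G : SimpleGraph V) (ρ : V → ℕ) (a v : V) (k : ℕ) : Prop :=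
  ∃ p : G.Walk a v, p.IsPath ∧ (∀ x ∈ p.support, ρ x ≤ ρ v) ∧ k ≤ p.length

lemma IsClimb.refl (ρ : V → ℕ) (a : V) : IsClimb G ρ a a 0 :=
  ⟨.nil, .nil, by simp, le_rfl⟩

lemma IsClimb.step {ρ : V → ℕ} {a v : V} {k : ℕ} (h : IsClimb G ρ a v k) {w : V}
    (hvw : G.Adj v w) (hρ : ρ v < ρ w) : IsClimb G ρ a w (k + 1) := by
  obtain ⟨p, hp, hle, hk⟩ := h
  refine ⟨p.concat hvw, hp.concat (fun hw => ?_) hvw, ?_, ?_⟩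
  · exact absurd (hle w hw) (by omega)
  · intro x hx
    rw [SimpleGraph.Walk.support_concat, List.mem_append] at hx
    rcases hx with hx | hx
    · exact (hle x hx).trans hρ.le
    · rw [List.mem_singleton.1 hx]
  · rw [SimpleGraph.Walk.length_concat]
    omega

lemma IsClimb.mono {ρ : V → ℕ} {a v : V} {k k' : ℕ} (h : IsClimb G ρ a v k) (hk : k' ≤ k) :
    IsClimb G ρ a v k' := by
  obtain ⟨p, hp, hle, hl⟩ := h
  exact ⟨p, hp, hle, hk.trans hl⟩

lemma length_le_longestPathLength [Fintype V] {u v : V} {p : G.Walk u v} (hp : p.IsPath) :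
    p.length ≤ longestPathLength G := by
  refine le_csSup ⟨Fintype.card V, ?_⟩ ⟨u, v, p, hp, rfl⟩
  rintro k ⟨a, b, q, hq, rfl⟩
  exact hq.length_lt.le

end PathNeighbours

/-! ### The second player's gadget -/

/-- Vertices of the gadget: the endpoints `((l, b), σ)` of the candidate edges `b` of the `l`-th
link, with `σ` telling left (`false`) from right (`true`); the `16 L` hinges; the `m` vertices
of each of the `17 L + 1` gaps; and `e` unused vertices. -/
abbrev GadgetVertex (L m e : ℕ) : Type :=
  ((Fin L × Bool) × Bool) ⊕ Fin (16 * L) ⊕ (Fin (17 * L + 1) × Fin m) ⊕ Fin e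

namespace GadgetVertex

variable {L m e : ℕ}

/-- An endpoint of a candidate edge. -/
abbrev link (t : (Fin L × Bool) × Bool) : GadgetVertex L m e := Sum.inl t

/-- A hinge. -/
abbrev hinge (u : Fin (16 * L)) : GadgetVertex L m e := Sum.inr (Sum.inl u)

/-- A vertex of a gap. -/
abbrev gap (w : Fin (17 * L + 1) × Fin m) : GadgetVertex L m e := Sum.inr (Sum.inr (Sum.inl w))

/-- An unused vertex. -/
abbrev spare (z : Fin e) : GadgetVertex L m e := Sum.inr (Sum.inr (Sum.inr z))

/-- The edges of the gadget, in one direction. Every gap is a path. The end of gap `j` and the start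
of gap `j + 1` are both joined to hinge `j` if `j < 16 L`; for `j = 16 L + l` they are joined to
the left, respectively right, endpoints of both candidate edges of link `l`. -/
def rel : GadgetVertex L m e → GadgetVertex L m e → Prop
  | .inr (.inr (.inl w)), .inr (.inr (.inl w')) => w.1 = w'.1 ∧ (w.2 : ℕ) + 1 = w'.2
  | .inr (.inr (.inl w)), .inl (t, false) => (w.2 : ℕ) + 1 = m ∧ (w.1 : ℕ) = 16 * L + t.1
  | .inr (.inr (.inl w)), .inl (t, true) => (w.2 : ℕ) = 0 ∧ (w.1 : ℕ) = 16 * L + t.1 + 1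
  | .inr (.inr (.inl w)), .inr (.inl u) =>
      ((w.2 : ℕ) + 1 = m ∧ (w.1 : ℕ) = u) ∨ ((w.2 : ℕ) = 0 ∧ (w.1 : ℕ) = u + 1)
  | _, _ => False

/-- The second player's graph. -/
def graph (L m e : ℕ) : SimpleGraph (GadgetVertex L m e) := SimpleGraph.fromRel rel

lemma graph_adj_gap_gap {w w' : Fin (17 * L + 1) × Fin m} :
    (graph L m e).Adj (gap w) (gap w') ↔
      w.1 = w'.1 ∧ ((w.2 : ℕ) + 1 = w'.2 ∨ (w'.2 : ℕ) + 1 = w.2) := by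
  simp only [graph, SimpleGraph.fromRel_adj, rel, ne_eq, Sum.inr.injEq, Sum.inl.injEq]
  constructor
  · rintro ⟨-, ⟨h, h'⟩ | ⟨h, h'⟩⟩
    · exact ⟨h, .inl h'⟩
    · exact ⟨h.symm, .inr h'⟩
  · rintro ⟨h, h' | h'⟩
    · exact ⟨by rintro rfl; omega, .inl ⟨h, h'⟩⟩
    · exact ⟨by rintro rfl; omega, .inr ⟨h.symm, h'⟩⟩

lemma graph_adj_gap_left {w : Fin (17 * L + 1) × Fin m} {t : Fin L × Bool} :
    (graph L m e).Adj (gap w) (link (t, false)) ↔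
      (w.2 : ℕ) + 1 = m ∧ (w.1 : ℕ) = 16 * L + t.1 := by
  simp [graph, SimpleGraph.fromRel_adj, rel]

lemma graph_adj_gap_right {w : Fin (17 * L + 1) × Fin m} {t : Fin L × Bool} :
    (graph L m e).Adj (gap w) (link (t, true)) ↔
      (w.2 : ℕ) = 0 ∧ (w.1 : ℕ) = 16 * L + t.1 + 1 := by
  simp [graph, SimpleGraph.fromRel_adj, rel]

lemma graph_adj_gap_hinge {w : Fin (17 * L + 1) × Fin m} {u : Fin (16 * L)} :
    (graph L m e).Adj (gap w) (hinge u) ↔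
      ((w.2 : ℕ) + 1 = m ∧ (w.1 : ℕ) = u) ∨ ((w.2 : ℕ) = 0 ∧ (w.1 : ℕ) = u + 1) := by
  simp [graph, SimpleGraph.fromRel_adj, rel]

lemma not_graph_adj_gap_spare {w : Fin (17 * L + 1) × Fin m} {z : Fin e} :
    ¬ (graph L m e).Adj (gap w) (spare z) := by
  simp [graph, SimpleGraph.fromRel_adj, rel]

/-- Every edge of the gadget has an endpoint in a gap. -/
lemma exists_gap_of_graph_adj {x y : GadgetVertex L m e} (h : (graph L m e).Adj x y) :
    (∃ w, x = gap w) ∨ ∃ w, y = gap w := by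
  rcases x with x | x | x | x <;> rcases y with y | y | y | y <;>
    simp [graph, SimpleGraph.fromRel_adj, rel] at h ⊢

/-- What the first player's graph `H` looks like from the gadget of one of the matchings: it avoids
the gaps and the unused vertices, and as the matching is induced, the only edges between link
vertices are candidate edges. -/
structure IsCompatible (H : SimpleGraph (GadgetVertex L m e)) : Prop where
  not_adj_gap : ∀ w v, ¬ H.Adj (gap w) v
  not_adj_spare : ∀ v z, ¬ H.Adj v (spare z)
  link_adj : ∀ t σ t' σ', H.Adj (link (t, σ)) (link (t', σ')) → t = t' ∧ σ' = !σ

section Upper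

variable {H : SimpleGraph (GadgetVertex L m e)}

lemma adj_gap_iff (hH : IsCompatible H) {w : Fin (17 * L + 1) × Fin m} {v : GadgetVertex L m e} :
    (H ⊔ graph L m e).Adj (gap w) v ↔ (graph L m e).Adj (gap w) v := by
  rw [SimpleGraph.sup_adj]
  exact ⟨fun h => h.resolve_left (hH.not_adj_gap w v), .inr⟩

/-- A link vertex has at most one neighbour in the gaps. -/
lemma gap_unique_of_adj_link (hH : IsCompatible H) {t : (Fin L × Bool) × Bool}
    {w w' : Fin (17 * L + 1) × Fin m}
    (h : (H ⊔ graph L m e).Adj (link t) (gap w)) (h' : (H ⊔ graph L m e).Adj (link t) (gap w')) :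
    w = w' := by
  rw [SimpleGraph.adj_comm, adj_gap_iff hH] at h h'
  obtain ⟨t, σ⟩ := t
  cases σ
  · rw [graph_adj_gap_left] at h h'
    exact Prod.ext (Fin.ext (by omega)) (Fin.ext (by omega))
  · rw [graph_adj_gap_right] at h h'
    exact Prod.ext (Fin.ext (by omega)) (Fin.ext (by omega))

variable {a b : GadgetVertex L m e} (p : (H ⊔ graph L m e).Walk a b)

/-- A gap is crossed by the path `p` if `p` visits an inner vertex of the gap and has no endpoint
in the gap. -/
def IsCrossed (g : Fin (17 * L + 1)) : Prop :=
  (∃ k : Fin m, 0 < (k : ℕ) ∧ (k : ℕ) + 1 < m ∧ gap (g, k) ∈ p.support) ∧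
    (∀ k, a ≠ gap (g, k)) ∧ ∀ k, b ≠ gap (g, k)

/-- A path that visits an inner vertex of a gap, and does not end in the gap, visits both
neighbours of that vertex. -/
lemma mem_support_of_inner (hH : IsCompatible H) (hp : p.IsPath) {g : Fin (17 * L + 1)}
    {k k' : Fin m} (ha : ∀ k, a ≠ gap (g, k)) (hb : ∀ k, b ≠ gap (g, k)) (h0 : 0 < (k : ℕ))
    (h1 : (k : ℕ) + 1 < m) (hk : gap (g, k) ∈ p.support)
    (hkk' : (k : ℕ) + 1 = k' ∨ (k' : ℕ) + 1 = k) : gap (g, k') ∈ p.support := by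
  classical
  have h2 := card_pathNeighbours_eq_two hp hk (ha k).symm (hb k).symm
  have hsub : (Finset.univ.filter fun y => s(gap (g, k), y) ∈ p.edges) ⊆
      {gap (g, ⟨k + 1, h1⟩), gap (g, ⟨k - 1, by omega⟩)} := by
    intro y hy
    have hadj := p.adj_of_mem_edges (Finset.mem_filter.1 hy).2
    rw [adj_gap_iff hH] at hadj
    simp only [Finset.mem_insert, Finset.mem_singleton]
    rcases y with ⟨t, _ | _⟩ | u | ⟨g', j⟩ | z
    · have := graph_adj_gap_left.1 hadj; simp only at this; omega
    · have := graph_adj_gap_right.1 hadj; simp only at this; omega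
    · have := graph_adj_gap_hinge.1 hadj; simp only at this; omega
    · obtain ⟨h3, h4⟩ := graph_adj_gap_gap.1 hadj
      simp only at h3 h4
      subst h3
      rcases h4 with h4 | h4
      · left; congr; exact Fin.ext h4.symm
      · right; congr; exact Fin.ext (show (j : ℕ) = k - 1 by omega)
    · exact absurd hadj not_graph_adj_gap_spare
  have heq := Finset.eq_of_subset_of_card_le hsub (Finset.card_le_two.trans h2.ge)
  have hmem : gap (g, k') ∈ (Finset.univ.filter fun y => s(gap (g, k), y) ∈ p.edges) := by
    rw [heq, Finset.mem_insert, Finset.mem_singleton]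
    rcases hkk' with h | h
    · left; congr; exact Fin.ext h.symm
    · right; congr; exact Fin.ext (show (k' : ℕ) = k - 1 by omega)
  exact p.snd_mem_support_of_mem_edges (Finset.mem_filter.1 hmem).2

/-- The end vertices of a crossed gap have a neighbour on the path outside the gaps. -/
lemma exists_exit (hH : IsCompatible H) (hp : p.IsPath) {g : Fin (17 * L + 1)} {k : Fin m}
    (ha : ∀ k, a ≠ gap (g, k)) (hb : ∀ k, b ≠ gap (g, k))
    (hk : gap (g, k) ∈ p.support) (hend : (k : ℕ) = 0 ∨ (k : ℕ) + 1 = m) :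
    (∃ t, s(gap (g, k), link t) ∈ p.edges) ∨ ∃ u, s(gap (g, k), hinge u) ∈ p.edges := by
  classical
  have h2 := card_pathNeighbours_eq_two hp hk (ha k).symm (hb k).symm
  by_contra! hno
  have hsub : ∀ y ∈ (Finset.univ.filter fun y => s(gap (g, k), y) ∈ p.edges),
      ∀ y' ∈ (Finset.univ.filter fun y => s(gap (g, k), y) ∈ p.edges), y = y' := by
    have key : ∀ y, s(gap (g, k), y) ∈ p.edges → ∃ j : Fin m, y = gap (g, j) ∧
        ((k : ℕ) + 1 = j ∨ (j : ℕ) + 1 = k) := by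
      intro y hy
      have hadj := p.adj_of_mem_edges hy
      rw [adj_gap_iff hH] at hadj
      rcases y with t | u | ⟨g', j⟩ | z
      · exact absurd hy (hno.1 t)
      · exact absurd hy (hno.2 u)
      · obtain ⟨h3, h4⟩ := graph_adj_gap_gap.1 hadj
        simp only at h3 h4
        subst h3
        exact ⟨j, rfl, h4⟩
      · exact absurd hadj not_graph_adj_gap_spare
    intro y hy y' hy'
    obtain ⟨j, rfl, hj⟩ := key y (Finset.mem_filter.1 hy).2
    obtain ⟨j', rfl, hj'⟩ := key y' (Finset.mem_filter.1 hy').2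
    congr 2
    apply Fin.ext
    omega
  have := Finset.card_le_one.2 hsub
  omega

/-- The path visits both ends of a crossed gap. -/
lemma mem_support_of_isCrossed (hH : IsCompatible H) (hp : p.IsPath) {g : Fin (17 * L + 1)}
    (hg : IsCrossed p g) {k : Fin m} (hend : (k : ℕ) = 0 ∨ (k : ℕ) + 1 = m) :
    gap (g, k) ∈ p.support := by
  obtain ⟨⟨k₀, h0, h1, hk₀⟩, ha, hb⟩ := hg
  have up : ∀ d, ∀ h : (k₀ : ℕ) + d < m, gap (g, ⟨k₀ + d, h⟩) ∈ p.support := by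
    intro d
    induction d with
    | zero => intro _; exact hk₀
    | succ d ih =>
      intro h
      exact mem_support_of_inner p hH hp ha hb (k := ⟨k₀ + d, by omega⟩)
        (show 0 < (k₀ : ℕ) + d by omega) (show (k₀ : ℕ) + d + 1 < m by omega) (ih (by omega))
        (.inl rfl)
  have down : ∀ d, d ≤ (k₀ : ℕ) → gap (g, ⟨k₀ - d, by omega⟩) ∈ p.support := by
    intro d
    induction d with
    | zero => intro _; exact hk₀
    | succ d ih =>
      intro h
      exact mem_support_of_inner p hH hp ha hb (k := ⟨k₀ - d, by omega⟩)
        (show 0 < (k₀ : ℕ) - d by omega) (show (k₀ : ℕ) - d + 1 < m by omega) (ih (by omega))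
        (.inr (show (k₀ : ℕ) - (d + 1) + 1 = k₀ - d by omega))
  rcases hend with h | h
  · have := down k₀ le_rfl
    convert this using 5
    omega
  · have := up (m - 1 - k₀) (by omega)
    convert this using 5
    omega

open Classical in
/-- Crossing gaps consumes hinges. A crossed gap is left through both of its ends. An exit to a
hinge uses up one of the two path edges at the hinge; an exit to a link vertex is followed by a
path edge to a hinge, except at the two endpoints of the path and at its candidate edges. -/
lemma card_isCrossed_le (hH : IsCompatible H) (hp : p.IsPath) (hm : 2 ≤ m) :
    (Finset.univ.filter (IsCrossed p)).card ≤
      16 * L + 1 + (Finset.univ.filter fun t : Fin L × Bool =>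
        s((link (t, false) : GadgetVertex L m e), link (t, true)) ∈ p.edges).card := by
  set D := Finset.univ.filter fun t : Fin L × Bool =>
    s((link (t, false) : GadgetVertex L m e), link (t, true)) ∈ p.edges with hD
  -- Path neighbours of each kind, for each kind of vertex.
  let linkGap : (Fin L × Bool) × Bool → ℕ := fun t =>
    (Finset.univ.filter fun w => s((link t : GadgetVertex L m e), gap w) ∈ p.edges).card
  let linkHinge : (Fin L × Bool) × Bool → ℕ := fun t =>
    (Finset.univ.filter fun u => s((link t : GadgetVertex L m e), hinge u) ∈ p.edges).card
  let hingeGap : Fin (16 * L) → ℕ := fun u =>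
    (Finset.univ.filter fun w => s((hinge u : GadgetVertex L m e), gap w) ∈ p.edges).card
  let hingeLink : Fin (16 * L) → ℕ := fun u =>
    (Finset.univ.filter fun t => s((link t : GadgetVertex L m e), hinge u) ∈ p.edges).card
  let gapLink : Fin (17 * L + 1) × Fin m → ℕ := fun w =>
    (Finset.univ.filter fun t => s((link t : GadgetVertex L m e), gap w) ∈ p.edges).card
  let gapHinge : Fin (17 * L + 1) × Fin m → ℕ := fun w =>
    (Finset.univ.filter fun u => s((hinge u : GadgetVertex L m e), gap w) ∈ p.edges).card
  have hdc1 : ∑ t, linkHinge t = ∑ u, hingeLink u :=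
    Finset.sum_card_bipartiteAbove_eq_sum_card_bipartiteBelow
      (fun t u => s((link t : GadgetVertex L m e), hinge u) ∈ p.edges)
  have hdc2 : ∑ t, linkGap t = ∑ w, gapLink w :=
    Finset.sum_card_bipartiteAbove_eq_sum_card_bipartiteBelow
      (fun t w => s((link t : GadgetVertex L m e), gap w) ∈ p.edges)
  have hdc3 : ∑ u, hingeGap u = ∑ w, gapHinge w :=
    Finset.sum_card_bipartiteAbove_eq_sum_card_bipartiteBelow
      (fun u w => s((hinge u : GadgetVertex L m e), gap w) ∈ p.edges)
  have hhinge : ∀ u, hingeLink u + hingeGap u ≤ 2 := by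
    intro u
    have h2 := card_pathNeighbours_le_two hp (hinge u)
    refine le_trans ?_ h2
    let F : Finset (GadgetVertex L m e) :=
      ((Finset.univ.filter fun t => s((link t : GadgetVertex L m e), hinge u) ∈ p.edges).map
        ⟨link, Sum.inl_injective⟩) ∪
      ((Finset.univ.filter fun w => s((hinge u : GadgetVertex L m e), gap w) ∈ p.edges).map
        ⟨gap, fun w w' h => by simpa using h⟩)
    have hF : F.card = hingeLink u + hingeGap u := by
      rw [Finset.card_union_of_disjoint, Finset.card_map, Finset.card_map]
      rw [Finset.disjoint_left]
      simp
    rw [← hF]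
    refine Finset.card_le_card fun y hy => ?_
    simp only [F, Finset.mem_union, Finset.mem_map, Finset.mem_filter, Finset.mem_univ, true_and,
      Function.Embedding.coeFn_mk] at hy ⊢
    rcases hy with ⟨t, ht, rfl⟩ | ⟨w, hw, rfl⟩
    · rwa [Sym2.eq_swap]
    · exact hw
  have hlink : ∀ t, linkGap t ≤ linkHinge t +
      (if link t = a then 1 else 0) + (if link t = b then 1 else 0) +
      (if t.1 ∈ D then 1 else 0) := by
    intro t
    have h1 : linkGap t ≤ 1 := Finset.card_le_one.2 fun w hw w' hw' =>
      gap_unique_of_adj_link hH (p.adj_of_mem_edges (Finset.mem_filter.1 hw).2)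
        (p.adj_of_mem_edges (Finset.mem_filter.1 hw').2)
    by_cases hta : link t = a
    · simp only [hta, if_true]; omega
    by_cases htb : link t = b
    · simp only [htb, if_true]; omega
    rcases Nat.eq_zero_or_pos (linkGap t) with h0 | h0
    · omega
    obtain ⟨w, hw⟩ := Finset.card_pos.1 h0
    have htp : link t ∈ p.support := p.fst_mem_support_of_mem_edges (Finset.mem_filter.1 hw).2
    have h2 := card_pathNeighbours_eq_two hp htp hta htb
    let F : Finset (GadgetVertex L m e) :=
      ((Finset.univ.filter fun w => s((link t : GadgetVertex L m e), gap w) ∈ p.edges).map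
        ⟨gap, fun w w' h => by simpa using h⟩) ∪
      ((Finset.univ.filter fun u => s((link t : GadgetVertex L m e), hinge u) ∈ p.edges).map
        ⟨hinge, fun w w' h => by simpa using h⟩) ∪
      (if t.1 ∈ D then {link (t.1, !t.2)} else ∅)
    have hF : F.card ≤ linkGap t + linkHinge t + (if t.1 ∈ D then 1 else 0) := by
      refine (Finset.card_union_le _ _).trans (add_le_add ((Finset.card_union_le _ _).trans ?_) ?_)
      · rw [Finset.card_map, Finset.card_map]
      · split_ifs <;> simp
    have hsub :
        (Finset.univ.filter fun y => s((link t : GadgetVertex L m e), y) ∈ p.edges) ⊆ F := by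
      intro y hy
      have hy := (Finset.mem_filter.1 hy).2
      have hadj := p.adj_of_mem_edges hy
      simp only [F, Finset.mem_union, Finset.mem_map, Finset.mem_filter, Finset.mem_univ, true_and]
      rcases y with ⟨t', σ'⟩ | u | w | z
      · right
        have hadjH : H.Adj (link (t.1, t.2)) (link (t', σ')) := by
          rcases hadj with h | h
          · exact h
          · rcases exists_gap_of_graph_adj h with ⟨w, hw⟩ | ⟨w, hw⟩ <;> simp at hw
        obtain ⟨h3, h4⟩ := hH.link_adj _ _ _ _ hadjH
        subst h3 h4
        have hmem : t.1 ∈ D := by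
          rw [hD, Finset.mem_filter]
          refine ⟨Finset.mem_univ _, ?_⟩
          obtain ⟨t, σ⟩ := t
          cases σ
          · exact hy
          · rw [Sym2.eq_swap]; exact hy
        rw [if_pos hmem, Finset.mem_singleton]
      · exact .inl (.inr ⟨u, hy, rfl⟩)
      · exact .inl (.inl ⟨w, hy, rfl⟩)
      · exfalso
        rcases hadj with h | h
        · exact hH.not_adj_spare _ z h
        · rcases exists_gap_of_graph_adj h with ⟨w, hw⟩ | ⟨w, hw⟩ <;> simp at hw
    have := Finset.card_le_card hsub
    simp only [hta, htb, if_false]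
    omega
  have hgap : ∀ g, IsCrossed p g → 2 ≤ ∑ k, (gapLink (g, k) + gapHinge (g, k)) := by
    intro g hg
    have hm0 : 0 < m := by omega
    have hone : ∀ k : Fin m, (k : ℕ) = 0 ∨ (k : ℕ) + 1 = m →
        1 ≤ gapLink (g, k) + gapHinge (g, k) := by
      intro k hk
      rcases exists_exit p hH hp hg.2.1 hg.2.2 (mem_support_of_isCrossed p hH hp hg hk) hk with
        ⟨t, ht⟩ | ⟨u, hu⟩
      · have : 0 < gapLink (g, k) :=
          Finset.card_pos.2 ⟨t, Finset.mem_filter.2 ⟨Finset.mem_univ _, Sym2.eq_swap ▸ ht⟩⟩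
        omega
      · have : 0 < gapHinge (g, k) :=
          Finset.card_pos.2 ⟨u, Finset.mem_filter.2 ⟨Finset.mem_univ _, Sym2.eq_swap ▸ hu⟩⟩
        omega
    have hne : (⟨0, hm0⟩ : Fin m) ≠ ⟨m - 1, by omega⟩ := by
      rw [Ne, Fin.mk.injEq]; omega
    calc 2 ≤ ∑ k ∈ {(⟨0, hm0⟩ : Fin m), ⟨m - 1, by omega⟩}, (gapLink (g, k) + gapHinge (g, k)) := by
          rw [Finset.sum_pair hne]
          exact add_le_add (hone _ (.inl rfl)) (hone _ (.inr (show m - 1 + 1 = m by omega)))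
      _ ≤ _ := Finset.sum_le_sum_of_subset (Finset.subset_univ _)
  have hlinksum : ∑ t, linkGap t ≤ ∑ t, linkHinge t + 2 + 2 * D.card := by
    have hpt : ∀ c : GadgetVertex L m e,
        ∑ t : (Fin L × Bool) × Bool, (if link t = c then 1 else 0) ≤ 1 := by
      intro c
      rw [← Finset.card_filter]
      exact Finset.card_le_one.2 fun t ht t' ht' => Sum.inl_injective
        ((Finset.mem_filter.1 ht).2.trans (Finset.mem_filter.1 ht').2.symm)
    have hDsum : ∑ t : (Fin L × Bool) × Bool, (if t.1 ∈ D then 1 else 0) = 2 * D.card := by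
      rw [Fintype.sum_prod_type]
      have h2 : ∀ x : Fin L × Bool, (∑ _σ : Bool, if x ∈ D then 1 else 0) =
          if x ∈ D then 2 else 0 := by
        intro x; split_ifs <;> simp
      rw [Finset.sum_congr rfl fun x _ => h2 x, Finset.sum_ite_mem, Finset.univ_inter,
        Finset.sum_const, smul_eq_mul, mul_comm]
    have hsum := Finset.sum_le_sum fun t (_ : t ∈ Finset.univ) => hlink t
    rw [Finset.sum_add_distrib, Finset.sum_add_distrib, Finset.sum_add_distrib, hDsum] at hsum
    have ha := hpt a
    have hb := hpt b
    omega
  have hhingesum : ∑ u, hingeLink u + ∑ u, hingeGap u ≤ 2 * (16 * L) := by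
    rw [← Finset.sum_add_distrib]
    refine (Finset.sum_le_sum fun u _ => hhinge u).trans ?_
    simp [mul_comm]
  have hgapsum : 2 * (Finset.univ.filter (IsCrossed p)).card ≤
      ∑ w, gapLink w + ∑ w, gapHinge w := by
    rw [← Finset.sum_add_distrib, Fintype.sum_prod_type, mul_comm, ← smul_eq_mul]
    refine (Finset.card_nsmul_le_sum _ _ _ fun g hg => hgap g (Finset.mem_filter.1 hg).2).trans ?_
    exact Finset.sum_le_sum_of_subset (Finset.subset_univ _)
  omega

open Classical in
/-- A path is not much longer than `m` times the number of gaps it crosses: at most two further gaps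
contain an endpoint, and of all other gaps it visits at most the two end vertices. -/
lemma length_le_card_isCrossed (hp : p.IsPath) :
    p.length ≤ m * ((Finset.univ.filter (IsCrossed p)).card + 2) + 2 * (17 * L + 1) +
      20 * L + e := by
  set S := p.support.toFinset with hS
  have hScard : S.card = p.length + 1 := by
    rw [hS, List.toFinset_card_of_nodup hp.support_nodup, SimpleGraph.Walk.length_support]
  let Wv : Finset (Fin (17 * L + 1) × Fin m) := Finset.univ.filter fun w => gap w ∈ S
  have hsub : S ⊆ (Finset.univ.map ⟨link, Sum.inl_injective⟩ ∪
      Finset.univ.map ⟨hinge, fun w w' h => by simpa using h⟩) ∪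
      (Wv.map ⟨gap, fun w w' h => by simpa using h⟩ ∪
      Finset.univ.map ⟨spare, fun w w' h => by simpa using h⟩) := by
    intro y hy
    simp only [Finset.mem_union, Finset.mem_map, Finset.mem_univ, true_and,
      Function.Embedding.coeFn_mk]
    rcases y with t | u | w | z
    · exact .inl (.inl ⟨t, rfl⟩)
    · exact .inl (.inr ⟨u, rfl⟩)
    · exact .inr (.inl ⟨w, Finset.mem_filter.2 ⟨Finset.mem_univ _, hy⟩, rfl⟩)
    · exact .inr (.inr ⟨z, rfl⟩)
  have h1 : S.card ≤ (4 * L + 16 * L) + (Wv.card + e) := by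
    refine (Finset.card_le_card hsub).trans ((Finset.card_union_le _ _).trans
      (add_le_add ((Finset.card_union_le _ _).trans (add_le_add ?_ ?_))
        ((Finset.card_union_le _ _).trans (add_le_add ?_ ?_))))
    · rw [Finset.card_map]; simp; omega
    · rw [Finset.card_map]; simp
    · rw [Finset.card_map]
    · rw [Finset.card_map]; simp
  let Bad : Finset (Fin (17 * L + 1)) :=
    Finset.univ.filter fun g => (∃ k, a = gap (g, k)) ∨ ∃ k, b = gap (g, k)
  have hBad : Bad.card ≤ 2 := by
    have hone : ∀ c : GadgetVertex L m e,
        (Finset.univ.filter fun g : Fin (17 * L + 1) => ∃ k, c = gap (g, k)).card ≤ 1 := by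
      intro c
      refine Finset.card_le_one.2 fun g hg g' hg' => ?_
      obtain ⟨k, hk⟩ := (Finset.mem_filter.1 hg).2
      obtain ⟨k', hk'⟩ := (Finset.mem_filter.1 hg').2
      rw [hk] at hk'
      simp only [Sum.inr.injEq, Sum.inl.injEq, Prod.mk.injEq] at hk'
      exact hk'.1
    have : Bad = (Finset.univ.filter fun g : Fin (17 * L + 1) => ∃ k, a = gap (g, k)) ∪
        (Finset.univ.filter fun g : Fin (17 * L + 1) => ∃ k, b = gap (g, k)) := by
      rw [← Finset.filter_or]
    rw [this]
    exact (Finset.card_union_le _ _).trans (add_le_add (hone a) (hone b))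
  have hW : Wv.card ≤
      ∑ g, ((if g ∈ Finset.univ.filter (IsCrossed p) ∪ Bad then m else 0) + 2) := by
    rw [Finset.card_eq_sum_card_fiberwise (f := Prod.fst) (t := Finset.univ) (by simp)]
    refine Finset.sum_le_sum fun g _ => ?_
    set Z := Wv.filter fun w => w.1 = g with hZ
    split_ifs with hg
    · refine le_trans ?_ (Nat.le_add_right m 2)
      have : Z.card ≤ (Finset.univ : Finset (Fin m)).card :=
        Finset.card_le_card_of_injOn Prod.snd (by simp) fun w hw w' hw' h =>
          Prod.ext ((Finset.mem_filter.1 hw).2.trans (Finset.mem_filter.1 hw').2.symm) h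
      simpa using this
    · rw [zero_add]
      have hends : ∀ w ∈ Z, (w.2 : ℕ) = 0 ∨ (w.2 : ℕ) + 1 = m := by
        rintro ⟨g', k⟩ hw
        obtain ⟨hw1, rfl⟩ := Finset.mem_filter.1 hw
        by_contra! hk
        apply hg
        have hk2 := k.2
        simp only at hk
        by_cases hbad : g' ∈ Bad
        · exact Finset.mem_union_right _ hbad
        · refine Finset.mem_union_left _ (Finset.mem_filter.2 ⟨Finset.mem_univ _, ?_⟩)
          simp only [Bad, Finset.mem_filter, Finset.mem_univ, true_and, not_or, not_exists] at hbad
          refine ⟨⟨k, by omega, by omega, ?_⟩, hbad.1, hbad.2⟩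
          simpa [Wv, hS] using hw1
      have : Z.card ≤ (Finset.univ : Finset Bool).card :=
        Finset.card_le_card_of_injOn (fun w => decide ((w.2 : ℕ) = 0))
          (fun _ _ => Finset.mem_coe.2 (Finset.mem_univ _)) fun w hw w' hw' h => by
            have h1 := hends w hw
            have h2 := hends w' hw'
            simp only [decide_eq_decide] at h
            refine Prod.ext ((Finset.mem_filter.1 hw).2.trans (Finset.mem_filter.1 hw').2.symm)
              (Fin.ext ?_)
            omega
      simpa using this
  have hsum : ∑ g, ((if g ∈ Finset.univ.filter (IsCrossed p) ∪ Bad then m else 0) + 2) =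
      m * (Finset.univ.filter (IsCrossed p) ∪ Bad).card + 2 * (17 * L + 1) := by
    rw [Finset.sum_add_distrib, Finset.sum_ite_mem, Finset.univ_inter]
    simp [mul_comm]
  have hunion : (Finset.univ.filter (IsCrossed p) ∪ Bad).card ≤
      (Finset.univ.filter (IsCrossed p)).card + 2 :=
    (Finset.card_union_le _ _).trans (by omega)
  have := Nat.mul_le_mul_left m hunion
  omega

end Upper

section Lower

variable {H : SimpleGraph (GadgetVertex L m e)}

/-- The order in which the long path visits the vertices. -/
def rank : GadgetVertex L m e → ℕ
  | .inl (t, σ) => (16 * L + t.1) * (m + 2) + m + σ.toNat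
  | .inr (.inl u) => u * (m + 2) + m
  | .inr (.inr (.inl w)) => w.1 * (m + 2) + w.2
  | .inr (.inr (.inr _)) => 0

/-- If one candidate edge of each link is present, then some path traverses all gaps in order. -/
lemma le_longestPathLength (hm : 0 < m)
    (hlink : ∀ l, ∃ b, H.Adj (link ((l, b), false)) (link ((l, b), true))) :
    (17 * L + 1) * m ≤ longestPathLength (H ⊔ graph L m e) + 1 := by
  set G := H ⊔ graph L m e with hG
  have hB : ∀ {x y}, (graph L m e).Adj x y → G.Adj x y := fun h => Or.inr h
  have hcross : ∀ (v : GadgetVertex L m e) (g : Fin (17 * L + 1)) (c : ℕ),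
      IsClimb G rank v (gap (g, ⟨0, hm⟩)) c →
      ∀ k, ∀ hk : k < m, IsClimb G rank v (gap (g, ⟨k, hk⟩)) (c + k) := by
    intro v g c h k
    induction k with
    | zero => intro _; exact h
    | succ k ih =>
      intro hk
      exact (ih (by omega)).step (hB (graph_adj_gap_gap.2 ⟨rfl, .inl rfl⟩))
        (by simp only [rank]; omega)
  have hstart : ∀ g, ∀ hg : g < 17 * L + 1,
      IsClimb G rank (gap (0, ⟨0, hm⟩)) (gap (⟨g, hg⟩, ⟨0, hm⟩)) (g * m) := by
    intro g
    induction g with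
    | zero => intro _; simpa using IsClimb.refl rank (gap (0, ⟨0, hm⟩))
    | succ g ih =>
      intro hg
      have hend := hcross _ _ _ (ih (by omega)) (m - 1) (by omega)
      have hmul : (g + 1) * (m + 2) = g * (m + 2) + m + 2 := by ring
      have hlen : (g + 1) * m = g * m + m := by ring
      by_cases hgL : g < 16 * L
      · have h1 := hend.step (w := hinge ⟨g, hgL⟩)
          (hB (graph_adj_gap_hinge.2 (.inl ⟨by simp only; omega, rfl⟩)))
          (by simp only [rank]; omega)
        have h2 := h1.step (w := gap (⟨g + 1, hg⟩, ⟨0, hm⟩))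
          (hB (graph_adj_gap_hinge.2 (.inr ⟨rfl, rfl⟩)).symm)
          (by simp only [rank]; omega)
        exact h2.mono (by omega)
      · obtain ⟨b, hb⟩ := hlink ⟨g - 16 * L, by omega⟩
        have hgl : 16 * L + (g - 16 * L) = g := by omega
        have h1 := hend.step (w := link ((⟨g - 16 * L, by omega⟩, b), false))
          (hB (graph_adj_gap_left.2 ⟨by simp only; omega, by simp only; omega⟩))
          (by simp only [rank, hgl, Bool.toNat_false]; omega)
        have h2 := h1.step (Or.inl hb) (by simp [rank])
        have h3 := h2.step (w := gap (⟨g + 1, hg⟩, ⟨0, hm⟩))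
          (hB (graph_adj_gap_right.2 ⟨rfl, by simp only; omega⟩).symm)
          (by simp only [rank, hgl, Bool.toNat_true]; omega)
        exact h3.mono (by omega)
  obtain ⟨p, hp, -, hlen⟩ :=
    hcross _ _ _ (hstart (17 * L) (by omega)) (m - 1) (by omega)
  have := length_le_longestPathLength hp
  have hmul : (17 * L + 1) * m = 17 * L * m + m := by ring
  omega

end Lower

open Classical in
/-- With gaps of a thousand vertices, a path shorter than a longest one by a factor of at most
`25 / 24` must use at least `L / 10` candidate edges. -/
theorem candidate_edges_of_approx {H : SimpleGraph (GadgetVertex L 1000 e)}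
    (hH : IsCompatible H) (hL : 100 ≤ L) (he : e ≤ L)
    (hlink : ∀ l, ∃ b, H.Adj (link ((l, b), false)) (link ((l, b), true)))
    {a b : GadgetVertex L 1000 e} (p : (H ⊔ graph L 1000 e).Walk a b) (hp : p.IsPath)
    (happrox : (longestPathLength (H ⊔ graph L 1000 e) : ℝ) ≤ 25 / 24 * p.length) :
    L ≤ 10 * (Finset.univ.filter fun t : Fin L × Bool =>
      s((link (t, false) : GadgetVertex L 1000 e), link (t, true)) ∈ p.edges).card := by
  have h1 := card_isCrossed_le p hH hp (by norm_num)
  have h2 := length_le_card_isCrossed p hp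
  have h3 := le_longestPathLength (e := e) (by norm_num) hlink
  have h4 : 24 * longestPathLength (H ⊔ graph L 1000 e) ≤ 25 * p.length := by
    have : (24 : ℝ) * longestPathLength (H ⊔ graph L 1000 e) ≤ 25 * p.length := by linarith
    exact_mod_cast this
  omega

end GadgetVertex

/-! ### The hard inputs -/

/-- An isomorphism carries paths to paths and preserves longest path lengths. -/
lemma longestPathLength_le_of_iso {V W : Type*} [Fintype V] [Fintype W] {G : SimpleGraph V}
    {G' : SimpleGraph W} (φ : G ≃g G') : longestPathLength G ≤ longestPathLength G' := by
  classical
  obtain _ | ⟨⟨v⟩⟩ := isEmpty_or_nonempty V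
  · simp [longestPathLength]
  · refine csSup_le ⟨0, v, v, .nil, .nil, rfl⟩ ?_
    rintro k ⟨a, b, p, hp, rfl⟩
    have := length_le_longestPathLength (p := p.map φ.toHom)
      (SimpleGraph.Walk.IsPath.map φ.injective hp)
    rwa [SimpleGraph.Walk.length_map] at this

/-- An injection extends to a bijection by any type of the right size. -/
lemma exists_sum_equiv {A B Y : Type} [Fintype A] [Fintype B] [Fintype Y] (f : A → Y)
    (hf : Function.Injective f) (hcard : Fintype.card Y = Fintype.card A + Fintype.card B) :
    ∃ ψ : A ⊕ B ≃ Y, ∀ a, ψ (.inl a) = f a := by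
  classical
  have h1 : Fintype.card (Set.range f) = Fintype.card A := Set.card_range_of_injective hf
  have h2 := Fintype.card_subtype_compl (fun y => y ∈ Set.range f)
  have h3 : Fintype.card B = Fintype.card {y // y ∉ Set.range f} := by
    rw [h2]
    have : Fintype.card {y // y ∈ Set.range f} = Fintype.card A := h1
    omega
  exact ⟨(Equiv.sumCongr (Equiv.ofInjective f hf) (Fintype.equivOfCardEq h3)).trans
    (Equiv.Set.sumCompl (Set.range f)), fun a => Equiv.Set.sumCompl_apply_inl _ _⟩

/-- The edge that the first player keeps from link `x.2` of matching `x.1`; the two copies of `X`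
are placed into the vertex set by `ι`. -/
def keptEdge {I X : Type} {L n : ℕ} (R : InducedMatchings I (Fin L × Bool) X)
    (ι : X × Bool → Fin n) (f : I × Fin L → Bool) (x : I × Fin L) : Sym2 (Fin n) :=
  s(ι (R.left x.1 (x.2, f x), false), ι (R.right x.1 (x.2, f x), true))

/-- The first player's graph: of the two candidate edges of every link, the one given by `f`. -/
def keptGraph {I X : Type} {L n : ℕ} (R : InducedMatchings I (Fin L × Bool) X)
    (ι : X × Bool → Fin n) (f : I × Fin L → Bool) : SimpleGraph (Fin n) :=
  SimpleGraph.fromEdgeSet (Set.range (keptEdge R ι f))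

section Kept

variable {I X : Type} {L n : ℕ} {R : InducedMatchings I (Fin L × Bool) X} {ι : X × Bool → Fin n}

lemma keptEdge_injective (hι : Function.Injective ι) (f : I × Fin L → Bool) :
    Function.Injective (keptEdge R ι f) := by
  rintro ⟨i, l⟩ ⟨j, l'⟩ h
  simp only [keptEdge, Sym2.eq_iff, hι.eq_iff, Prod.mk.injEq, and_true, reduceCtorEq, and_false,
    or_false] at h
  obtain rfl := R.induced j i _ _ _ h.1 h.2
  have := R.left_injective i h.1
  rw [Prod.mk.injEq] at this
  rw [this.1]

lemma edgeSet_keptGraph (hι : Function.Injective ι) (f : I × Fin L → Bool) :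
    (keptGraph R ι f).edgeSet = Set.range (keptEdge R ι f) := by
  rw [keptGraph, SimpleGraph.edgeSet_fromEdgeSet, sdiff_eq_left, Set.disjoint_left]
  rintro _ ⟨x, rfl⟩ h
  simp [keptEdge, hι.eq_iff] at h

lemma keptGraph_adj_iff (hι : Function.Injective ι) {f : I × Fin L → Bool} {x y : Fin n} :
    (keptGraph R ι f).Adj x y ↔ ∃ z, keptEdge R ι f z = s(x, y) := by
  rw [← SimpleGraph.mem_edgeSet, edgeSet_keptGraph hι, Set.mem_range]

lemma mem_range_of_keptGraph_adj (hι : Function.Injective ι) {f : I × Fin L → Bool} {x y : Fin n}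
    (h : (keptGraph R ι f).Adj x y) : x ∈ Set.range ι := by
  obtain ⟨z, hz⟩ := (keptGraph_adj_iff hι).1 h
  rw [keptEdge, Sym2.eq_iff] at hz
  rcases hz with ⟨h, -⟩ | ⟨-, h⟩
  · exact ⟨_, h⟩
  · exact ⟨_, h⟩

/-- As the matchings are induced, a kept edge between endpoints of matching `i` belongs to it. -/
lemma eq_of_keptGraph_adj (hι : Function.Injective ι) {f : I × Fin L → Bool} {i : I}
    {t t' : Fin L × Bool}
    (h : (keptGraph R ι f).Adj (ι (R.left i t, false)) (ι (R.right i t', true))) :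
    t = t' ∧ f (i, t.1) = t.2 := by
  obtain ⟨⟨j, l⟩, hz⟩ := (keptGraph_adj_iff hι).1 h
  simp only [keptEdge, Sym2.eq_iff, hι.eq_iff, Prod.mk.injEq, and_true, reduceCtorEq, and_false,
    or_false] at hz
  obtain rfl := R.induced i j _ _ _ hz.1 hz.2
  have h1 := R.left_injective j hz.1
  have h2 := R.right_injective j hz.2
  subst h1
  exact ⟨h2, rfl⟩

end Kept

/-- Hard inputs on `n` vertices. The first player holds a bit `f (i, l)` for every link `l` of every
matching `i`, the second player an index `i`. The vertex list of a `25 / 24`-approximate longest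
path of their union determines a tenth of the bits of matching `i`. -/
structure HardInputs (n L : ℕ) (I : Type) where
  /-- The first player's edge for a link. -/
  edge : (I × Fin L → Bool) → I × Fin L → Sym2 (Fin n)
  /-- The first player's graph. -/
  alice : (I × Fin L → Bool) → SimpleGraph (Fin n)
  /-- The second player's graph. -/
  bob : I → SimpleGraph (Fin n)
  edge_injective : ∀ f, Function.Injective (edge f)
  edgeSet_alice : ∀ f, (alice f).edgeSet = Set.range (edge f)
  disjoint : ∀ f i, Disjoint (alice f) (bob i)
  determines : ∀ (i : I) (l : List (Fin n)), ∃ (P : Finset (Fin L)) (g : Fin L → Bool),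
    L ≤ 10 * P.card ∧
      ∀ f, IsApproxLongestPath (25 / 24) (alice f ⊔ bob i) l → ∀ x ∈ P, f (i, x) = g x

/-- Hard inputs from induced matchings: the first player keeps one candidate edge of each link, and
the second player adds a copy of the gadget placed along matching `i`. -/
theorem nonempty_hardInputs {I X : Type} [Fintype X] {L e n : ℕ}
    (R : InducedMatchings I (Fin L × Bool) X) (hX : Fintype.card X = 10 * L) (hL : 100 ≤ L)
    (he : e ≤ L) (hn : n = 20 * L + (17 * L + 1) * 1000 + e) : Nonempty (HardInputs n L I) := by
  classical
  have hV : Fintype.card (X × Bool ⊕ (Fin (17 * L + 1) × Fin 1000) ⊕ Fin e) =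
      Fintype.card (Fin n) := by
    simp only [Fintype.card_sum, Fintype.card_prod, Fintype.card_fin, Fintype.card_bool, hX, hn]
    ring
  let θ := Fintype.equivOfCardEq hV
  let ι : X × Bool → Fin n := fun y => θ (.inl y)
  have hι : Function.Injective ι := θ.injective.comp Sum.inl_injective
  have hplace : ∀ i, ∃ Φ : GadgetVertex L 1000 e ≃ Fin n,
      (∀ t, Φ (.link (t, false)) = ι (R.left i t, false)) ∧
      (∀ t, Φ (.link (t, true)) = ι (R.right i t, true)) ∧
      (∀ w, Φ (.gap w) ∉ Set.range ι) ∧ ∀ z, Φ (.spare z) ∉ Set.range ι := by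
    intro i
    obtain ⟨ψ, hψ⟩ := exists_sum_equiv (B := Fin (16 * L))
      (fun t : (Fin L × Bool) × Bool => ((if t.2 then R.right i t.1 else R.left i t.1 : X), t.2))
      (by
        rintro ⟨t, σ⟩ ⟨t', σ'⟩ h
        simp only [Prod.mk.injEq] at h
        obtain ⟨h, rfl⟩ := h
        cases σ
        · exact Prod.ext (R.left_injective i (by simpa using h)) rfl
        · exact Prod.ext (R.right_injective i (by simpa using h)) rfl)
      (by
        simp only [Fintype.card_prod, Fintype.card_fin, Fintype.card_bool, hX]
        ring)
    refine ⟨((Equiv.sumAssoc _ _ _).symm.trans (Equiv.sumCongr ψ (Equiv.refl _))).trans θ,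
      fun t => ?_, fun t => ?_, fun w => ?_, fun z => ?_⟩
    · simp [hψ, ι]
    · simp [hψ, ι]
    · rintro ⟨y, hy⟩
      simp [ι] at hy
    · rintro ⟨y, hy⟩
      simp [ι] at hy
  choose Φ hleft hright hgap hspare using hplace
  have hcompat : ∀ f i, GadgetVertex.IsCompatible ((keptGraph R ι f).comap (Φ i)) := by
    intro f i
    refine ⟨fun w v h => ?_, fun v z h => ?_, fun t σ t' σ' h => ?_⟩
    · exact hgap i w (mem_range_of_keptGraph_adj hι h)
    · exact hspare i z (mem_range_of_keptGraph_adj hι h.symm)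
    · rw [SimpleGraph.comap_adj] at h
      cases σ <;> cases σ'
      · exfalso
        obtain ⟨z, hz⟩ := (keptGraph_adj_iff hι).1 h
        simp [hleft, keptEdge, hι.eq_iff] at hz
      · rw [hleft, hright] at h
        exact ⟨(eq_of_keptGraph_adj hι h).1, rfl⟩
      · rw [hleft, hright] at h
        exact ⟨(eq_of_keptGraph_adj hι h.symm).1.symm, rfl⟩
      · exfalso
        obtain ⟨z, hz⟩ := (keptGraph_adj_iff hι).1 h
        simp [hright, keptEdge, hι.eq_iff] at hz
  have hlink : ∀ f i l, ∃ b, ((keptGraph R ι f).comap (Φ i)).Adj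
      (GadgetVertex.link ((l, b), false)) (GadgetVertex.link ((l, b), true)) := by
    intro f i l
    refine ⟨f (i, l), ?_⟩
    rw [SimpleGraph.comap_adj, hleft, hright]
    exact (keptGraph_adj_iff hι).2 ⟨(i, l), rfl⟩
  let GB : I → SimpleGraph (Fin n) := fun i => (GadgetVertex.graph L 1000 e).comap (Φ i).symm
  refine ⟨⟨keptEdge R ι, keptGraph R ι, GB, keptEdge_injective hι, edgeSet_keptGraph hι,
    fun f i => ?_, fun i l => ?_⟩⟩
  · rw [SimpleGraph.disjoint_left]
    intro x y hA hB
    rcases GadgetVertex.exists_gap_of_graph_adj hB with ⟨w, hw⟩ | ⟨w, hw⟩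
    · rw [Equiv.symm_apply_eq] at hw
      exact hgap i w (hw ▸ mem_range_of_keptGraph_adj hι hA)
    · rw [Equiv.symm_apply_eq] at hw
      exact hgap i w (hw ▸ mem_range_of_keptGraph_adj hι hA.symm)
  · -- The candidate edges along `l`. They lie in every graph in which `l` is a path.
    let D : Finset (Fin L × Bool) := Finset.univ.filter fun t =>
      s(Φ i (.link (t, false)), Φ i (.link (t, true))) ∈
        List.zipWith (fun x y => s(x, y)) l l.tail
    have hD : ∀ f, IsApproxLongestPath (25 / 24) (keptGraph R ι f ⊔ GB i) l →
        L ≤ 10 * D.card ∧ ∀ t ∈ D, f (i, t.1) = t.2 := by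
      rintro f ⟨a, b, p, hp, rfl, happ⟩
      have hedges : ∀ t, t ∈ D ↔
          s(Φ i (.link (t, false)), Φ i (.link (t, true))) ∈ p.edges := by
        intro t
        rw [SimpleGraph.Walk.edges_eq_zipWith_support]
        simp [D]
      let φ : (keptGraph R ι f ⊔ GB i) ≃g
          ((keptGraph R ι f).comap (Φ i) ⊔ GadgetVertex.graph L 1000 e) :=
        { toEquiv := (Φ i).symm
          map_rel_iff' := by
            intro x y
            simp [GB] }
      have hmain := GadgetVertex.candidate_edges_of_approx (hcompat f i) hL he (hlink f i)
        (p.map φ.toHom) (SimpleGraph.Walk.IsPath.map φ.injective hp) (by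
          rw [SimpleGraph.Walk.length_map]
          refine le_trans ?_ happ
          exact_mod_cast longestPathLength_le_of_iso φ.symm)
      refine ⟨hmain.trans (Nat.mul_le_mul_left _ (Finset.card_le_card fun t ht => ?_)), ?_⟩
      · rw [hedges]
        have ht := (Finset.mem_filter.1 ht).2
        rw [SimpleGraph.Walk.edges_map, List.mem_map] at ht
        obtain ⟨d, hd, hdt⟩ := ht
        have : d = s(Φ i (.link (t, false)), Φ i (.link (t, true))) := by
          have h := congrArg (Sym2.map (Φ i)) hdt
          rw [Sym2.map_map, Sym2.map_mk] at h
          rw [← h]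
          have hid : (Φ i) ∘ φ.toHom = id := by
            ext x
            simp [φ]
          rw [hid, Sym2.map_id, id]
        rwa [← this]
      · intro t ht
        rcases p.adj_of_mem_edges ((hedges t).1 ht) with h | h
        · rw [hleft, hright] at h
          exact (eq_of_keptGraph_adj hι h).2
        · exfalso
          rw [SimpleGraph.comap_adj, Equiv.symm_apply_apply, Equiv.symm_apply_apply] at h
          rcases GadgetVertex.exists_gap_of_graph_adj h with ⟨w, hw⟩ | ⟨w, hw⟩ <;> simp at hw
    by_cases hex : ∃ f, IsApproxLongestPath (25 / 24) (keptGraph R ι f ⊔ GB i) l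
    · obtain ⟨f₀, hf₀⟩ := hex
      refine ⟨D.image Prod.fst, fun x => f₀ (i, x), ?_, ?_⟩
      · rw [Finset.card_image_of_injOn]
        · exact (hD f₀ hf₀).1
        · intro t ht t' ht' h
          refine Prod.ext h ?_
          rw [← (hD f₀ hf₀).2 t ht, ← (hD f₀ hf₀).2 t' ht', h]
      · intro f hf x hx
        obtain ⟨t, ht, rfl⟩ := Finset.mem_image.1 hx
        exact ((hD f hf).2 t ht).trans ((hD f₀ hf₀).2 t ht).symm
    · refine ⟨Finset.univ, fun _ => true, ?_, fun f hf => absurd ⟨f, hf⟩ hex⟩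
      rw [Finset.card_univ, Fintype.card_fin]
      omega

/-! ### Growth rates -/

/-- `r` of order `log n / log log n` makes the Ruzsa–Szemerédi graph fit into `n` vertices, while
the number of its matchings is `n ^ Ω(1 / log log n)`. -/
lemma eventually_exists_radius (B : ℕ) (C : ℝ) (hC : 0 < C) :
    ∀ᶠ n : ℕ in Filter.atTop, ∃ r : ℕ, 0 < r ∧ B * (5 * r) ^ (8 * r) ≤ n ∧
      (n : ℝ) ^ (1 / 64 / Real.log (Real.log n)) ≤ C * (27 / 16) ^ r := by
  have hx : Filter.Tendsto (fun n : ℕ => Real.log n) Filter.atTop Filter.atTop :=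
    Real.tendsto_log_atTop.comp tendsto_natCast_atTop_atTop
  have hy : Filter.Tendsto (fun n : ℕ => Real.log (Real.log n)) Filter.atTop Filter.atTop :=
    Real.tendsto_log_atTop.comp hx
  have hxy : Filter.Tendsto (fun n : ℕ => Real.exp (Real.log (Real.log n)) /
      Real.log (Real.log n) ^ 1) Filter.atTop Filter.atTop :=
    (Real.tendsto_exp_div_pow_atTop 1).comp hy
  filter_upwards [hx.eventually_gt_atTop 0, hy.eventually_ge_atTop 1,
    hxy.eventually_ge_atTop 16, hxy.eventually_ge_atTop (64 * (1 / 2 - Real.log C)),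
    Filter.eventually_ge_atTop (B ^ 2), Filter.eventually_gt_atTop 0]
    with n hx0 hy1 hz16 hzC hnB hn0
  set x := Real.log n with hxdef
  set y := Real.log x with hydef
  rw [Real.exp_log hx0, pow_one] at hz16 hzC
  have hn0' : (0 : ℝ) < n := by exact_mod_cast hn0
  have hexp : Real.exp x = n := Real.exp_log hn0'
  have hy0 : 0 < y := by linarith
  set r := ⌊x / y / 16⌋₊ with hr
  have hr1 : 1 ≤ r := Nat.le_floor (by push_cast; linarith)
  have hrle : (r : ℝ) ≤ x / y / 16 := Nat.floor_le (by positivity)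
  have hrge : x / y / 16 - 1 ≤ r := by
    have := Nat.lt_floor_add_one (x / y / 16)
    linarith
  have hr0 : (0 : ℝ) < r := by exact_mod_cast hr1
  refine ⟨r, hr1, ?_, ?_⟩
  · have h5r : 5 * (r : ℝ) ≤ x := by
      have : x / y ≤ x := div_le_self hx0.le hy1
      linarith
    have hpow : ((5 * r : ℝ)) ^ (8 * r) ≤ Real.exp (x / 2) := by
      calc ((5 * r : ℝ)) ^ (8 * r) ≤ x ^ (8 * r) := by gcongr
        _ = Real.exp (y * (8 * r)) := by
            rw [← Real.exp_log hx0, ← hydef, ← Real.exp_nat_mul]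
            push_cast
            rw [mul_comm]
        _ ≤ Real.exp (x / 2) := by
            rw [Real.exp_le_exp]
            have : y * r ≤ y * (x / y / 16) := by gcongr
            have h2 : y * (x / y / 16) = x / 16 := by field_simp
            linarith
    have hB : (B : ℝ) ≤ Real.exp (x / 2) := by
      have h1 : (B : ℝ) ^ 2 ≤ Real.exp (x / 2) ^ 2 := by
        rw [← Real.exp_nat_mul]
        have : ((2 : ℕ) : ℝ) * (x / 2) = x := by push_cast; ring
        rw [this, hexp]
        exact_mod_cast hnB
      exact le_of_sq_le_sq h1 (Real.exp_pos _).le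
    have : (B : ℝ) * (5 * r) ^ (8 * r) ≤ n := by
      calc _ ≤ Real.exp (x / 2) * Real.exp (x / 2) := by gcongr
        _ = n := by rw [← Real.exp_add, add_halves, hexp]
    exact_mod_cast this
  · have hbase : Real.exp (1 / 2) ≤ 27 / 16 := by
      have h1 : Real.exp (1 / 2) ^ 2 ≤ (27 / 16) ^ 2 := by
        rw [← Real.exp_nat_mul]
        have : ((2 : ℕ) : ℝ) * (1 / 2) = 1 := by norm_num
        rw [this]
        have := Real.exp_one_lt_d9
        norm_num at this ⊢
        linarith
      exact le_of_sq_le_sq h1 (by norm_num)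
    calc (n : ℝ) ^ (1 / 64 / y) = Real.exp (x / y / 64) := by
          rw [Real.rpow_def_of_pos hn0']
          congr 1
          ring
      _ ≤ Real.exp (Real.log C + r * (1 / 2)) := by
          rw [Real.exp_le_exp]
          linarith
      _ = C * Real.exp (1 / 2) ^ r := by
          rw [Real.exp_add, Real.exp_log hC, Real.exp_nat_mul]
      _ ≤ _ := by gcongr

/-- Hard inputs exist for all large `n`, with a linear number of links per matching and
`n ^ Ω(1 / log log n)` matchings. Disjoint copies of one Ruzsa–Szemerédi graph fill up the `n`
vertices. -/
lemma eventually_exists_hardInputs (C : ℝ) (hC : 0 < C) :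
    ∀ᶠ n : ℕ in Filter.atTop, ∃ (I : Type) (_ : Fintype I) (_ : DecidableEq I) (L : ℕ),
      Nonempty (HardInputs n L I) ∧ n ≤ 20000 * L ∧ 0 < Fintype.card I ∧
      (n : ℝ) ^ (1 / 64 / Real.log (Real.log n)) ≤ C * Fintype.card I := by
  -- There are `17020` vertices per link. The factor `10 ^ 9` leaves room for that many copies, so
  -- that there are fewer unused vertices than links.
  filter_upwards [eventually_exists_radius 1000000000 C hC] with n hn
  obtain ⟨r, hr, hrn, hrC⟩ := hn
  obtain ⟨I, _, _, X, _, q, R, hI, hXq, hX⟩ := exists_inducedMatchings r hr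
  rw [← hX, hXq] at hrn
  have hq : 0 < q := by
    have : 0 < (5 * r) ^ (8 * r) := by positivity
    omega
  obtain ⟨M, hM⟩ : ∃ M, M = (n - 1000) / (17020 * q) := ⟨_, rfl⟩
  have hdiv := Nat.div_add_mod (n - 1000) (17020 * q)
  have hmod := Nat.mod_lt (n - 1000) (show 0 < 17020 * q by omega)
  rw [← hM] at hdiv
  have hM1 : 17020 ≤ M := by
    rw [hM, Nat.le_div_iff_mul_le (by omega)]
    omega
  have hqM : 17020 * q ≤ q * M := by
    rw [mul_comm]; exact Nat.mul_le_mul_left q hM1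
  have hassoc : 17020 * q * M = 17020 * (q * M) := by ring
  let φ : Fin (q * M) × Bool ≃ Fin q × (Fin M × Bool) :=
    (Equiv.prodCongr finProdFinEquiv.symm (Equiv.refl Bool)).trans (Equiv.prodAssoc _ _ _)
  have hpos : (0 : ℝ) < Fintype.card I := lt_of_lt_of_le (by positivity) hI
  refine ⟨I, inferInstance, inferInstance, q * M,
    nonempty_hardInputs (R.copies (Fin M × Bool) φ) (e := (n - 1000) % (17020 * q)) ?_ ?_ ?_ ?_,
    ?_, by exact_mod_cast hpos, hrC.trans (by gcongr)⟩
  · simp only [Fintype.card_prod, Fintype.card_fin, Fintype.card_bool, hXq]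
    ring
  · omega
  · omega
  · omega
  · omega

/-! ### The lower bound -/

/-- Recovering a good approximate path on hard inputs takes long messages, for an arbitrary source
of randomness `Ω` that both players know. -/
theorem exists_hardInputs_message_length (ε : ℝ) (hε : 0 < ε) (hε1 : ε < 1) :
    ∃ n₀ : ℕ, ∀ n : ℕ, n₀ ≤ n → ∃ (I : Type) (_ : Fintype I) (L : ℕ) (𝓗 : HardInputs n L I),
      ∀ (Ω : Type) [MeasurableSpace Ω] (μ : MeasureTheory.Measure Ω)
        [MeasureTheory.IsProbabilityMeasure μ] (msg : Ω → (I × Fin L → Bool) → List Bool)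
        (out : Ω → I → List Bool → List (Fin n)) (s : ℕ), (∀ ω f, (msg ω f).length ≤ s) →
        (∀ f i, μ.real {ω | ¬ IsApproxLongestPath (25 / 24) (𝓗.alice f ⊔ 𝓗.bob i)
          (out ω i (msg ω f))} ≤ ε) →
        (n : ℝ) ^ (1 + 1 / 64 / Real.log (Real.log n)) ≤ s := by
  set δ := 1 - ε with hδ
  have hδ0 : 0 < δ := by linarith
  obtain ⟨b, hb⟩ := exists_pow_lt_of_lt_one (show 0 < δ / 2 by linarith)
    (show (1 / 2 : ℝ) < 1 by norm_num)
  -- The constant is `20000 * 80`: the message has at least `δ L |I| / 80` bits, and `n ≤ 20000 L`.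
  have hev := eventually_exists_hardInputs (δ / 1600000) (by positivity)
  have hrate : Filter.Tendsto (fun n : ℕ => (n : ℝ)) Filter.atTop Filter.atTop :=
    tendsto_natCast_atTop_atTop
  obtain ⟨n₀, hn₀⟩ := Filter.eventually_atTop.1 (hev.and
    ((hrate.eventually_ge_atTop (20000 * (160 * (1 + b) / δ + 160 / δ))).and
    ((((Real.tendsto_log_atTop.comp Real.tendsto_log_atTop).comp hrate).eventually_ge_atTop 0).and
    (Filter.eventually_gt_atTop 0))))
  refine ⟨n₀, fun n hn => ?_⟩
  obtain ⟨⟨I, _, _, L, ⟨𝓗⟩, hnL, hI, hgrow⟩, hnbig, hy, hn0⟩ := hn₀ n hn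
  refine ⟨I, inferInstance, L, 𝓗, ?_⟩
  intro Ω _ μ _ msg out s hs hfail
  have : Nonempty I := Fintype.card_pos_iff.1 hI
  set t := Fintype.card I with ht
  set h := ⌊δ / 2 * t⌋₊ with hh
  have hmain := message_length_bound μ msg s hs
    (fun ω f i => IsApproxLongestPath (25 / 24) (𝓗.alice f ⊔ 𝓗.bob i) (out ω i (msg ω f)))
    ((L + 9) / 10) h (fun ω m i => by
      obtain ⟨P, g, hP, hg⟩ := 𝓗.determines i (out ω i m)
      exact ⟨P, g, by omega, fun f hf hc => hg f (hf ▸ hc)⟩) ε hfail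
    (Nat.floor_le (by positivity))
  obtain ⟨K, hK⟩ : ∃ K, K = (L + 9) / 10 := ⟨_, rfl⟩
  rw [← hK] at hmain
  have hexp : K * h ≤ s + 1 + t + b := by
    have h1 : (2 : ℝ) ^ (K * h) ≤ 2 ^ (s + 1 + t + b) := by
      have h2 : (1 / 2 : ℝ) ^ b * 2 ^ (K * h) ≤ 2 ^ (s + 1 + t) :=
        le_trans (by gcongr) hmain
      calc (2 : ℝ) ^ (K * h) = (1 / 2 : ℝ) ^ b * 2 ^ (K * h) * 2 ^ b := by
            rw [mul_right_comm, ← mul_pow]; norm_num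
        _ ≤ 2 ^ (s + 1 + t) * 2 ^ b := by gcongr
        _ = _ := (pow_add _ _ _).symm
    exact (pow_le_pow_iff_right₀ (by norm_num)).1 h1
  have hexpR : (K : ℝ) * h ≤ s + 1 + t + b := by exact_mod_cast hexp
  have hKR : (L : ℝ) ≤ 10 * K := by
    have : L ≤ 10 * K := by omega
    exact_mod_cast this
  have hhR : δ / 2 * t ≤ h + 1 := (Nat.lt_floor_add_one _).le
  have hn1 : (1 : ℝ) ≤ n := by exact_mod_cast hn0
  have hpow1 : (1 : ℝ) ≤ (n : ℝ) ^ (1 / 64 / Real.log (Real.log n)) :=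
    Real.one_le_rpow hn1 (div_nonneg (by norm_num) hy)
  have hδt : 1600000 ≤ δ * t := by
    have := hpow1.trans hgrow
    linarith
  have hnLR : (n : ℝ) ≤ 20000 * L := by exact_mod_cast hnL
  have hL1 : 160 * (1 + b) / δ + 160 / δ ≤ L := by linarith
  have hδL : 160 * (1 + b) + 160 ≤ δ * L := by
    rw [← add_div, div_le_iff₀ hδ0] at hL1
    linarith
  have ht1 : (1 : ℝ) ≤ t := by exact_mod_cast hI
  have hb0 : (0 : ℝ) ≤ b := Nat.cast_nonneg b
  have hL0 : (0 : ℝ) ≤ L := Nat.cast_nonneg L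
  have hh0 : (0 : ℝ) ≤ h := Nat.cast_nonneg h
  -- The lower order terms `L / 10` and `1 + b + t` are at most `δ L t / 80`.
  have e1 : (L : ℝ) * (δ / 2 * t - 1) ≤ 10 * (K * h) := by
    have h1 : (L : ℝ) * (δ / 2 * t - 1) ≤ L * h := mul_le_mul_of_nonneg_left (by linarith) hL0
    have h2 : (L : ℝ) * h ≤ 10 * K * h := mul_le_mul_of_nonneg_right hKR hh0
    linarith
  have e2 : (L : ℝ) * 8 ≤ L * (δ * t) := mul_le_mul_of_nonneg_left (by linarith) hL0
  have e3 : (160 : ℝ) * t ≤ δ * L * t := mul_le_mul_of_nonneg_right (by linarith) (by linarith)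
  have e4 : (160 * (1 + b) : ℝ) * 1 ≤ δ * L * t :=
    mul_le_mul (by linarith) ht1 (by norm_num) (by positivity)
  have e5 : (n : ℝ) * (δ / 1600000 * t) ≤ 20000 * L * (δ / 1600000 * t) :=
    mul_le_mul_of_nonneg_right hnLR (by positivity)
  calc (n : ℝ) ^ (1 + 1 / 64 / Real.log (Real.log n))
      = n * (n : ℝ) ^ (1 / 64 / Real.log (Real.log n)) := by
        rw [Real.rpow_add (by linarith), Real.rpow_one]
    _ ≤ n * (δ / 1600000 * t) := by gcongr
    _ ≤ s := by linarith

/-- Relaxing the approximation factor. -/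
lemma IsApproxLongestPath.mono {V : Type*} [Fintype V] {α β : ℝ} {G : SimpleGraph V} {l : List V}
    (h : IsApproxLongestPath α G l) (hαβ : α ≤ β) : IsApproxLongestPath β G l := by
  obtain ⟨u, v, p, hp, hl, hle⟩ := h
  exact ⟨u, v, p, hp, hl, hle.trans (by gcongr)⟩

instance : MeasureTheory.IsProbabilityMeasure coinMeasure := by
  unfold coinMeasure
  infer_instance

/-- Resuming a streaming algorithm in the middle of the stream. -/
lemma StreamingAlgorithm.memory_append {n : ℕ} (A : StreamingAlgorithm n) (ω : Coins)
    (l l' : List (Sym2 (Fin n))) :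
    A.memory ω (l ++ l') =
      (l'.zipIdx l.length).foldl (fun σ e => A.update ω e.2 σ e.1) (A.memory ω l) := by
  rw [StreamingAlgorithm.memory, List.zipIdx_append, List.foldl_append, zero_add]
  rfl

lemma StreamingAlgorithm.length_memory_le {n : ℕ} (A : StreamingAlgorithm n) {s : ℕ}
    (hs : A.space ≤ s) {G : SimpleGraph (Fin n)} {l : List (Sym2 (Fin n))}
    (hl : IsInsertionStream G l) (ω : Coins) : (A.memory ω l).length ≤ s := by
  have h : (((A.memory ω (l.take l.length)).length : ℕ) : ℕ∞) ≤ A.space :=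
    le_iSup_of_le G (le_iSup_of_le l (le_iSup_of_le hl (le_iSup_of_le l.length
      (le_iSup_of_le ω le_rfl))))
  rw [List.take_length] at h
  exact_mod_cast h.trans hs

theorem theorem4 (γ : ℝ) (hγ : 0 < γ) (ε : ℝ) (hε : 0 < ε) (hε1 : ε < 1) :
    ∃ c : ℝ, 0 < c ∧ ∃ n₀ : ℕ, ∀ n : ℕ, n₀ ≤ n →
      (∀ P : OneWayProtocol (SimpleGraph (Fin n)) (SimpleGraph (Fin n)) (List (Fin n)),
        P.SolvesLongestPath (25 / 24 - γ) ε →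
        ∀ s : ℕ, P.cost ≤ (s : ℕ∞) →
          (n : ℝ) ^ (1 + c / Real.log (Real.log (n : ℝ))) ≤ (s : ℝ)) ∧
      (∀ A : StreamingAlgorithm n,
        A.SolvesLongestPath (25 / 24 - γ) ε →
        ∀ s : ℕ, A.space ≤ (s : ℕ∞) →
          (n : ℝ) ^ (1 + c / Real.log (Real.log (n : ℝ))) ≤ (s : ℝ)) := by
  classical
  obtain ⟨n₀, hn₀⟩ := exists_hardInputs_message_length ε hε hε1
  refine ⟨1 / 64, by norm_num, n₀, fun n hn => ?_⟩
  obtain ⟨I, _, L, 𝓗, hbound⟩ := hn₀ n hn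
  constructor
  · intro P hP s hs
    refine hbound (Coins × Coins × Coins) (coinMeasure.prod (coinMeasure.prod coinMeasure))
      (fun ω f => P.message (𝓗.alice f) ω.1 ω.2.1)
      (fun ω i m => P.output (𝓗.bob i) m ω.1 ω.2.2) s (fun ω f => ?_) (fun f i => ?_)
    · have h : (((P.message (𝓗.alice f) ω.1 ω.2.1).length : ℕ) : ℕ∞) ≤ P.cost :=
        le_iSup_of_le (𝓗.alice f) (le_iSup_of_le ω.1 (le_iSup_of_le ω.2.1 le_rfl))
      exact_mod_cast h.trans hs
    · refine (MeasureTheory.measureReal_mono ?_).trans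
        (hP (𝓗.alice f) (𝓗.bob i) (𝓗.disjoint f i))
      intro ω hω h
      exact hω (h.mono (by linarith))
  · intro A hA s hs
    -- The first player feeds her edges to the algorithm and sends the memory contents. Their number
    -- is the same for all inputs, so the second player knows where to resume the edge count.
    let la : (I × Fin L → Bool) → List (Sym2 (Fin n)) := fun f =>
      (Finset.univ : Finset (I × Fin L)).toList.map (𝓗.edge f)
    let lb : I → List (Sym2 (Fin n)) := fun i => (𝓗.bob i).edgeFinset.toList
    have hla : ∀ f, IsInsertionStream (𝓗.alice f) (la f) := by
      intro f
      refine ⟨(Finset.nodup_toList _).map (𝓗.edge_injective f), fun e => ?_⟩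
      simp [la, 𝓗.edgeSet_alice f]
    have hlen : ∀ f, (la f).length = Fintype.card (I × Fin L) := by
      intro f
      simp only [la, List.length_map, Finset.length_toList, Finset.card_univ]
    have hlab : ∀ f i, IsInsertionStream (𝓗.alice f ⊔ 𝓗.bob i) (la f ++ lb i) := by
      intro f i
      refine ⟨(hla f).1.append (Finset.nodup_toList _) fun e he he' => ?_, fun e => ?_⟩
      · rw [(hla f).2] at he
        have he'' : e ∈ (𝓗.bob i).edgeSet := by simpa [lb] using he'
        exact Set.disjoint_left.1 (SimpleGraph.disjoint_edgeSet.2 (𝓗.disjoint f i)) he he''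
      · rw [List.mem_append, (hla f).2, SimpleGraph.edgeSet_sup, Set.mem_union]
        simp [lb]
    refine hbound Coins coinMeasure (fun ω f => A.memory ω (la f))
      (fun ω i σ => A.output ω (((lb i).zipIdx (Fintype.card (I × Fin L))).foldl
        (fun σ e => A.update ω e.2 σ e.1) σ)) s
      (fun ω f => A.length_memory_le hs (hla f) ω) (fun f i => ?_)
    refine (MeasureTheory.measureReal_mono ?_).trans (hA _ _ (hlab f i))
    intro ω hω h
    rw [A.memory_append, hlen] at h
    exact hω (h.mono (by linarith))
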